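/- All posets are finite and considered up to isomorphism (unlabelled). The number of layers $\ell(P)$ of a poset $P$ is the cardinality of a longest chain in $P$; subsets of $P$ carry the induced order. A subset $A \subseteq B$ is maximally ordered in $B$ if the number of pairs $(a,b) \in A \times A$ with $a<b$ is maximal among all subsets of $B$ of cardinality $|A|$. Let $P$ be a poset, $Q$ a finite poset and $r \ge 2$ an integer. For an automorphism $\sigma$ of $P$ let $\Sigma(\sigma) = \{a \in P : \sigma(a) \ne a\}$. Consider sequences $(S_i)_{i \in \mathbb{Z}/r}$ of proper subsets $S_i \subset \Sigma(\sigma)$, each maximally ordered in $\Sigma(\sigma)$, with $\sigma(S_i) = S_{i+1}$, $\ell(S_i) = \ell(\Sigma(\sigma))$ for all $i$, and $\bigcup_i S_i = \Sigma(\sigma)$. If $(S_i)$ is such a sequence with $|S_i|$ smallest possible among all such sequences for $\sigma$ and $r$, and $S_i \cong Q$ for all $i$, then $\sigma$ is called a $(Q,r)$-generator, with cycle $(S_i)$. Elements $a,b \in P$ are directly $(Q,r)$-symmetric if for some $(Q,r)$-generator $\sigma$ with cycle $(S_i)$ there are $i,j$ with $S_i \ne S_j$, $a \in S_i$, $b \in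 S_j$, and $b = \sigma^q(a)$ for some $1 \le q < r$; they are $(Q,r)$-symmetric if they are joined by a finite (possibly empty) sequence of direct $(Q,r)$-symmetries. The retract $P \oslash_r Q$ is the set of equivalence classes of $(Q,r)$-symmetric elements, ordered by $A \le B$ iff $a \le b$ for some $a \in A$, $b \in B$. The poset $P$ is locally symmetric if $P \oslash_r Q \not\cong P$ for some finite poset $Q$ and some $r \ge 2$, and locally unsymmetric otherwise. For integers $n \ge 0$ and $l$, let $p(n,l)$ be the number of unlabelled posets with $n$ elements and exactly $l$ layers, and $u(n,l)$ the number of those that are locally unsymmetric. **Theorem.** For $n < 3$, $p(n,n-2) = u(n,n-2) = 0$. For $n \ge 3$, $$p(n,n-2) = \tfrac16 (n-2)\bigl(n^3-2n^2-5n+12\bigr), \qquad u(n,n-2) = \tfrac16 (n-3)\bigl(n^3-4n^2+2n-2\bigr).$$ -/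

import Mathlib

namespace LocalSym

universe u v

section Basic

variable {P : Type u} [PartialOrder P]

/-- The number of layers `ℓ(A)` of a subset `A` of a poset (with the induced order):
the cardinality of a longest chain contained in `A`. -/
noncomputable def layers (A : Set P) : ℕ∞ := A.chainHeight (· ≤ ·)

/-- The set `Σ(σ)` of all elements not fixed by the automorphism `σ`. -/
def moved (σ : P ≃o P) : Set P := {a | σ a ≠ a}

/-- The ordered pairs `a < b` of elements of `A`. -/
def orderedPairs (A : Set P) : Set (P × P) := {x | x.1 ∈ A ∧ x.2 ∈ A ∧ x.1 < x.2}

/-- `A ⊆ B` is maximally ordered in `B`: the number of ordered pairs in `A` is maximal among all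
subsets of `B` with the cardinality of `A`. -/
def MaximallyOrderedIn (A B : Set P) : Prop :=
  A ⊆ B ∧ ∀ A' : Set P, A' ⊆ B → A'.encard = A.encard →
    (orderedPairs A').encard ≤ (orderedPairs A).encard

/-- A sequence of `r` proper subsets of `Σ(σ)`, maximally ordered in `Σ(σ)`, permuted cyclically
by `σ`, with the same number of layers as `Σ(σ)`, and covering `Σ(σ)`. The indices
`0, …, r - 1` modulo `r` are the elements of `ZMod r`. -/
structure IsCycle (σ : P ≃o P) (r : ℕ) (S : ZMod r → Set P) : Prop where
  ssubset : ∀ i, S i ⊂ moved σ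
  maximallyOrdered : ∀ i, MaximallyOrderedIn (S i) (moved σ)
  image : ∀ i, σ '' S i = S (i + 1)
  layers_eq : ∀ i, layers (S i) = layers (moved σ)
  iUnion_eq : ⋃ i, S i = moved σ

/-- The sequence `S` witnesses that `σ` is a `(Q, r)`-generator: it is a cycle of subsets
isomorphic to `Q`, and these are smallest possible. -/
structure IsGeneratorCycle (Q : Type v) [PartialOrder Q] (r : ℕ) (σ : P ≃o P)
    (S : ZMod r → Set P) : Prop where
  two_le : 2 ≤ r
  cycle : IsCycle σ r S
  iso : ∀ i, Nonempty (S i ≃o Q)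
  smallest : ∀ T : ZMod r → Set P, IsCycle σ r T → ∀ i, (S i).encard ≤ (T i).encard

/-- `a` and `b` are `(Q, r, 1)`-symmetric: they lie in distinct members `A`, `B` of the sequence
of subsets of a `(Q, r)`-generator `σ`, and `b = σ ^ q a` for some `1 ≤ q < r`. -/
def StepSymmetric (Q : Type v) [PartialOrder Q] (r : ℕ) (a b : P) : Prop :=
  ∃ (σ : P ≃o P) (S : ZMod r → Set P), IsGeneratorCycle Q r σ S ∧
    ∃ i j, S i ≠ S j ∧ a ∈ S i ∧ b ∈ S j ∧ ∃ q : ℕ, 1 ≤ q ∧ q < r ∧ b = σ^[q] a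

/-- `a` and `b` are `(Q, r)`-symmetric: they are joined by a finite (possibly empty) sequence of
`(Q, r, 1)`-symmetries. -/
def SymmetricElements (Q : Type v) [PartialOrder Q] (r : ℕ) (a b : P) : Prop :=
  Relation.ReflTransGen (StepSymmetric Q r) a b

theorem moved_symm (σ : P ≃o P) : moved σ.symm = moved σ := by
  ext a
  change ¬ σ.symm a = a ↔ ¬ σ a = a
  rw [OrderIso.symm_apply_eq]
  exact not_congr eq_comm

theorem IsCycle.symm {σ : P ≃o P} {r : ℕ} {S : ZMod r → Set P} (h : IsCycle σ r S) :
    IsCycle σ.symm r (fun i => S (-i)) where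
  ssubset i := by rw [moved_symm]; exact h.ssubset _
  maximallyOrdered i := by rw [moved_symm]; exact h.maximallyOrdered _
  image i := by
    have h1 := h.image (-(i + 1))
    rw [show -(i + 1) + 1 = -i by ring] at h1
    rw [← h1, Set.image_image]
    simp
  layers_eq i := by rw [moved_symm]; exact h.layers_eq _
  iUnion_eq := by
    rw [moved_symm, ← h.iUnion_eq]
    exact (Equiv.neg (ZMod r)).surjective.iUnion_comp S

theorem IsGeneratorCycle.symm {Q : Type v} [PartialOrder Q] {r : ℕ} {σ : P ≃o P}
    {S : ZMod r → Set P} (h : IsGeneratorCycle Q r σ S) :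
    IsGeneratorCycle Q r σ.symm (fun i => S (-i)) where
  two_le := h.two_le
  cycle := h.cycle.symm
  iso i := h.iso _
  smallest T hT i := by simpa using h.smallest _ hT.symm (-i)

theorem StepSymmetric.symm {Q : Type v} [PartialOrder Q] {r : ℕ} {a b : P}
    (h : StepSymmetric Q r a b) : StepSymmetric Q r b a := by
  obtain ⟨σ, S, hS, i, j, hij, ha, hb, q, hq1, hq2, hq⟩ := h
  refine ⟨σ.symm, _, hS.symm, -j, -i, ?_, ?_, ?_, q, hq1, hq2, ?_⟩
  · simpa using hij.symm
  · simpa using hb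
  · simpa using ha
  · rw [hq]
    exact ((Function.LeftInverse.iterate σ.symm_apply_apply q) a).symm

/-- The equivalence relation given by the `(Q, r)`-symmetries. -/
def symmSetoid (P : Type u) [PartialOrder P] (Q : Type v) [PartialOrder Q] (r : ℕ) :
    Setoid P where
  r := SymmetricElements Q r
  iseqv :=
    { refl := fun _ => Relation.ReflTransGen.refl
      symm := fun h => by
        have : Std.Symm (StepSymmetric (P := P) Q r) := ⟨fun _ _ h' => h'.symm⟩
        exact Relation.ReflTransGen.stdSymm.symm _ _ h
      trans := fun h h' => Relation.ReflTransGen.trans h h' }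

theorem IsGeneratorCycle.ne_succ {Q : Type v} [PartialOrder Q] {r : ℕ} {σ : P ≃o P}
    {S : ZMod r → Set P} (h : IsGeneratorCycle Q r σ S) (i : ZMod r) : S i ≠ S (i + 1) := by
  intro he
  have : NeZero r := ⟨by have := h.two_le; omega⟩
  have key : ∀ k : ℕ, S (i + k) = S i := by
    intro k
    induction k with
    | zero => simp
    | succ k ih =>
      rw [show i + ((k + 1 : ℕ) : ZMod r) = i + k + 1 by push_cast; ring, ← h.cycle.image, ih,
        h.cycle.image, ← he]
  have hall : ∀ j, S j = S i := by
    intro j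
    have := key (j - i).val
    rwa [ZMod.natCast_zmod_val, add_sub_cancel] at this
  refine (h.cycle.ssubset i).ne ?_
  rw [← h.cycle.iUnion_eq]
  simp only [hall, Set.iUnion_const]

theorem IsGeneratorCycle.symmetric_apply {Q : Type v} [PartialOrder Q] {r : ℕ} {σ : P ≃o P}
    {S : ZMod r → Set P} (h : IsGeneratorCycle Q r σ S) (a : P) : SymmetricElements Q r a (σ a) := by
  by_cases ha : σ a = a
  · rw [ha]
    exact Relation.ReflTransGen.refl
  · have hm : a ∈ ⋃ i, S i := by
      rw [h.cycle.iUnion_eq]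
      exact ha
    obtain ⟨i, hi⟩ := Set.mem_iUnion.1 hm
    have h2 := h.two_le
    refine Relation.ReflTransGen.single ⟨σ, S, h, i, i + 1, h.ne_succ i, hi, ?_, 1, le_rfl,
      by omega, rfl⟩
    rw [← h.cycle.image]
    exact ⟨a, hi, rfl⟩

theorem SymmetricElements.exists_automorphism {Q : Type v} [PartialOrder Q] {r : ℕ} {a b : P}
    (h : SymmetricElements Q r a b) : ∃ g : P ≃o P, g a = b ∧ ∀ x, SymmetricElements Q r x (g x) := by
  induction h with
  | refl => exact ⟨OrderIso.refl P, rfl, fun _ => Relation.ReflTransGen.refl⟩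
  | tail _ hs ih =>
    obtain ⟨g, hg, hx⟩ := ih
    obtain ⟨σ, S, hS, i, j, -, -, -, q, -, -, hq⟩ := hs
    have key : ∀ k : ℕ, ∃ τ : P ≃o P, (∀ x, τ x = σ^[k] x) ∧ ∀ x, SymmetricElements Q r x (τ x) := by
      intro k
      induction k with
      | zero => exact ⟨OrderIso.refl P, fun _ => rfl, fun _ => Relation.ReflTransGen.refl⟩
      | succ k ih =>
        obtain ⟨τ, h1, h2⟩ := ih
        refine ⟨τ.trans σ, fun x => ?_, fun x => (h2 x).trans (hS.symmetric_apply _)⟩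
        rw [Function.iterate_succ_apply', ← h1]
        rfl
    obtain ⟨τ, h1, h2⟩ := key q
    refine ⟨g.trans τ, ?_, fun x => (hx x).trans (h2 _)⟩
    rw [hq, ← hg, ← h1]
    rfl

theorem apply_eq_of_le_apply [Finite P] (k : P ≃o P) {a : P} (h : a ≤ k a) : k a = a := by
  by_contra hne
  have hlt : a < k a := lt_of_le_of_ne h (Ne.symm hne)
  exact not_injective_infinite_finite _
    (k.strictMono.strictMono_iterate_of_lt_map hlt).injective

end Basic

/-- The retract `P ⊘_r Q`: the quotient of `P` by all `(Q, r)`-symmetries. -/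
def Retract (P : Type u) [PartialOrder P] (Q : Type v) [PartialOrder Q] (r : ℕ) : Type u :=
  Quotient (symmSetoid P Q r)

/-- The order of the retract: `A ≤ B` if and only if `a ≤ b` for some `a ∈ A` and `b ∈ B`. -/
instance (P : Type u) [PartialOrder P] [Finite P] (Q : Type v) [PartialOrder Q] (r : ℕ) :
    PartialOrder (Retract P Q r) where
  le A B := ∃ a b : P, Quotient.mk (symmSetoid P Q r) a = A ∧
    Quotient.mk (symmSetoid P Q r) b = B ∧ a ≤ b
  le_refl A := by
    obtain ⟨a, ha⟩ := Quotient.exists_rep A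
    exact ⟨a, a, ha, ha, le_rfl⟩
  le_trans := by
    rintro A B C ⟨a, b, rfl, rfl, hab⟩ ⟨b', c, hb, rfl, hbc⟩
    have hb' : SymmetricElements Q r b b' := Quotient.exact hb.symm
    obtain ⟨g, hg, hx⟩ := hb'.exists_automorphism
    refine ⟨g a, c, (Quotient.sound (hx a)).symm, rfl, le_trans ?_ hbc⟩
    rw [← hg]
    exact g.monotone hab
  le_antisymm := by
    rintro A B ⟨a, b, rfl, rfl, hab⟩ ⟨b', a', hb, ha, hba⟩
    have hb' : SymmetricElements Q r b' b := Quotient.exact hb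
    have ha' : SymmetricElements Q r a a' := Quotient.exact ha.symm
    obtain ⟨g, hg, -⟩ := hb'.exists_automorphism
    obtain ⟨k, hk, -⟩ := ha'.exists_automorphism
    have h1 : b ≤ g (k a) := by
      rw [← hg, hk]
      exact g.monotone hba
    have h2 : g (k a) = a := apply_eq_of_le_apply (k.trans g) (hab.trans h1)
    rw [h2] at h1
    rw [le_antisymm hab h1]

/-- `P` is locally `(Q, r)`-symmetric (`(Q, r)`-retractable): the retract `P ⊘_r Q` is a different
poset from `P`; posets are considered up to isomorphism. -/
def IsLocallySymmetricBy (P : Type u) [PartialOrder P] [Finite P] (Q : Type v) [PartialOrder Q]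
    (r : ℕ) : Prop :=
  ¬ Nonempty (P ≃o Retract P Q r)

/-- `P` is locally symmetric: it is locally `(Q, r)`-symmetric for some finite poset `Q` and
some `r ≥ 2`. -/
def IsLocallySymmetric (P : Type u) [PartialOrder P] [Finite P] : Prop :=
  ∃ (Q : Type) (_ : PartialOrder Q) (_ : Finite Q) (r : ℕ), 2 ≤ r ∧ IsLocallySymmetricBy P Q r

/-- `P` is locally unsymmetric: it is not locally symmetric. -/
def IsLocallyUnsymmetric (P : Type u) [PartialOrder P] [Finite P] : Prop :=
  ¬ IsLocallySymmetric P

/-- Isomorphism of the partial orders on an `n`-element set. -/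
def isoSetoid (n : ℕ) : Setoid (PartialOrder (Fin n)) where
  r o₁ o₂ := Nonempty (@OrderIso (Fin n) (Fin n) o₁.toLE o₂.toLE)
  iseqv :=
    { refl := fun o => ⟨@OrderIso.refl (Fin n) o.toLE⟩
      symm := fun {o₁ o₂} ⟨e⟩ => ⟨@OrderIso.symm (Fin n) (Fin n) o₁.toLE o₂.toLE e⟩
      trans := fun {o₁ o₂ o₃} ⟨e⟩ ⟨f⟩ =>
        ⟨@OrderIso.trans (Fin n) (Fin n) (Fin n) o₁.toLE o₂.toLE o₃.toLE e f⟩ }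

/-- The unlabelled posets with `n` elements: isomorphism classes of `n`-element posets. -/
def UnlabelledPoset (n : ℕ) : Type := Quotient (isoSetoid n)

/-- The poset `P` has (exactly) `l` layers. -/
def HasLayers (P : Type u) [PartialOrder P] (l : ℤ) : Prop :=
  ∃ k : ℕ, layers (Set.univ : Set P) = k ∧ (k : ℤ) = l

/-- `p(n, l)`: the number of unlabelled posets with `n` elements and `l` layers. -/
noncomputable def numPosets (n : ℕ) (l : ℤ) : ℕ :=
  Set.ncard {x : UnlabelledPoset n | ∃ o : PartialOrder (Fin n),
    Quotient.mk (isoSetoid n) o = x ∧ @HasLayers (Fin n) o l}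

/-- `u(n, l)`: the number of locally unsymmetric unlabelled posets with `n` elements and
`l` layers. -/
noncomputable def numLocallyUnsymmetric (n : ℕ) (l : ℤ) : ℕ :=
  Set.ncard {x : UnlabelledPoset n | ∃ o : PartialOrder (Fin n),
    Quotient.mk (isoSetoid n) o = x ∧ @HasLayers (Fin n) o l ∧
      @IsLocallyUnsymmetric (Fin n) o inferInstance}

end LocalSym

/-! ### Codes for a chain with two further elements -/

namespace LocalSym

/-- A code for a poset consisting of a chain `0 < 1 < ⋯ < m - 1` and two further elements `x`, `y`:
the elements of the chain below `x` are those `< p`, the ones above `x` are those `≥ q`; the ones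
below `y` are those `< r`, the ones above `y` are those `≥ s`; and `x < y` if and only if `e = 1`. -/
@[ext] structure ChainCode where
  (p q r s e : ℕ)

namespace ChainCode

/-- The strict order described by a code, with `m` and `m + 1` in the roles of `x` and `y`. -/
def Rel (m : ℕ) (C : ChainCode) (u v : ℕ) : Prop :=
  (u < v ∧ v < m) ∨ (u < C.p ∧ v = m) ∨ (u = m ∧ C.q ≤ v ∧ v < m) ∨ (u < C.r ∧ v = m + 1) ∨
    (u = m + 1 ∧ C.s ≤ v ∧ v < m) ∨ (u = m ∧ v = m + 1 ∧ C.e = 1)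

/-- The code describes a strict order in which the chain has maximal length. -/
structure Valid (m : ℕ) (C : ChainCode) : Prop where
  p_lt_q : C.p < C.q
  q_le : C.q ≤ m
  r_lt_s : C.r < C.s
  s_le : C.s ≤ m
  e_le : C.e ≤ 1
  of_not_lt : C.e = 0 → C.r ≤ C.q ∧ C.p ≤ C.s
  of_lt : C.e = 1 → C.p ≤ C.r ∧ C.q ≤ C.s ∧ C.p + 2 ≤ C.s

/-- The codes from which one is chosen in each isomorphism class. -/
structure Normal (m : ℕ) (C : ChainCode) : Prop where
  p_lt_q : C.p < C.q
  q_le : C.q ≤ m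
  r_lt_s : C.r < C.s
  s_le : C.s ≤ m
  p_le_r : C.p ≤ C.r
  cases : (C.e = 0 ∧ C.p = C.r ∧ C.q ≤ C.s) ∨ (C.e = 0 ∧ C.p < C.r ∧ C.r ≤ C.q) ∨
    (C.e = 1 ∧ C.p = C.r ∧ C.p + 2 ≤ C.q ∧ C.q ≤ C.s) ∨
    (C.e = 1 ∧ C.p < C.r ∧ (C.q ≤ C.r ∨ (C.r < C.q ∧ C.q ≤ C.s ∧ C.r + 2 ≤ C.s)))

/-- The normal codes of posets without nontrivial automorphisms. -/
def Rigid (C : ChainCode) : Prop :=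
  (C.e = 0 ∧ C.p = C.r ∧ C.p + 1 < C.q ∧ C.q < C.s) ∨
    (C.e = 0 ∧ C.p < C.r ∧ (C.q = C.r ∨ C.r + 1 < C.s)) ∨
    (C.e = 1 ∧ C.p = C.r ∧ C.p + 2 < C.s) ∨
    (C.e = 1 ∧ C.p < C.r ∧ (C.r < C.q ∨ (C.p + 1 < C.q ∧ C.r + 1 < C.s)))

variable {m : ℕ} {C C' : ChainCode}

theorem Normal.valid (h : Normal m C) : Valid m C := by
  obtain ⟨h1, h2, h3, h4, h5, h6⟩ := h
  constructor <;> omega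

theorem Rel.irrefl (h : Valid m C) (u : ℕ) : ¬ Rel m C u u := by
  obtain ⟨h1, h2, h3, h4, h5, h6, h7⟩ := h
  unfold Rel
  omega

theorem Rel.trans (h : Valid m C) {u v w : ℕ} (h1 : Rel m C u v) (h2 : Rel m C v w) :
    Rel m C u w := by
  obtain ⟨g1, g2, g3, g4, g5, g6, g7⟩ := h
  unfold Rel at h1 h2 ⊢
  rcases h1 with h1 | h1 | h1 | h1 | h1 | h1 <;> rcases h2 with h2 | h2 | h2 | h2 | h2 | h2 <;>
    omega

/-- The poset described by a valid code. -/
abbrev order (h : Valid m C) : PartialOrder (Fin (m + 2)) where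
  le u v := u = v ∨ Rel m C u v
  lt u v := Rel m C u v
  le_refl _ := Or.inl rfl
  le_trans u v w := by
    rintro (rfl | h1) (rfl | h2)
    · exact Or.inl rfl
    · exact Or.inr h2
    · exact Or.inr h1
    · exact Or.inr (h1.trans h h2)
  le_antisymm u v := by
    rintro (rfl | h1) (h2 | h2)
    · rfl
    · rfl
    · exact h2.symm
    · exact absurd (h1.trans h h2) (Rel.irrefl h _)
  lt_iff_le_not_ge u v := by
    constructor
    · intro h1
      refine ⟨Or.inr h1, ?_⟩
      rintro (rfl | h2)
      · exact Rel.irrefl h _ h1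
      · exact Rel.irrefl h _ (h1.trans h h2)
    · rintro ⟨rfl | h1, h2⟩
      · exact absurd (Or.inl rfl) h2
      · exact h1

/-- The height of an element of the poset described by a normal code. -/
def height (m : ℕ) (C : ChainCode) (u : ℕ) : ℕ :=
  if u < m then u else if u = m then C.p else if C.e = 1 ∧ C.p = C.r then C.p + 1 else C.r

theorem height_of_lt {u : ℕ} (h : u < m) : height m C u = u := if_pos h

theorem height_self : height m C m = C.p := by simp [height]

theorem height_succ :
    height m C (m + 1) = if C.e = 1 ∧ C.p = C.r then C.p + 1 else C.r := by simp [height]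

theorem height_lt (h : Normal m C) (u : ℕ) : height m C u < m := by
  obtain ⟨h1, h2, h3, h4, h5, h6⟩ := h
  unfold height
  split_ifs <;> omega

theorem height_strictMono (h : Normal m C) {u v : ℕ} (hr : Rel m C u v) :
    height m C u < height m C v := by
  obtain ⟨h1, h2, h3, h4, h5, h6⟩ := h
  unfold Rel at hr
  unfold height
  split_ifs <;> omega

/-- Together with `height_strictMono` this identifies the height as the largest size of a chain
strictly below an element. The chain supplies the predecessor, except for y when e = 1 and p = r:
then c_p is not below y, and x takes its place. -/
theorem exists_rel_of_height_eq (h : Normal m C) {v k : ℕ} (hv : v < m + 2)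
    (hk : height m C v = k + 1) : ∃ u, u < m + 2 ∧ Rel m C u v ∧ height m C u = k := by
  obtain ⟨h1, h2, h3, h4, h5, h6⟩ := h
  by_cases hc : v = m + 1 ∧ C.e = 1 ∧ C.p = C.r
  · refine ⟨m, by omega, by unfold Rel; omega, ?_⟩
    obtain ⟨rfl, hc⟩ := hc
    rw [height_succ, if_pos hc] at hk
    rw [height_self]
    omega
  · unfold height at hk
    have hkm : k < m := by split_ifs at hk <;> omega
    refine ⟨k, by omega, ?_, height_of_lt hkm⟩
    unfold Rel
    split_ifs at hk <;> omega

/-- A strictly monotone grading with a predecessor in each smaller degree is unique. -/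
theorem grading_unique {α : Type*} [Finite α] {R : α → α → Prop} {f g : α → ℕ}
    (hf : ∀ u v, R u v → f u < f v) (hg : ∀ u v, R u v → g u < g v)
    (hf' : ∀ v k, f v = k + 1 → ∃ u, R u v ∧ f u = k)
    (hg' : ∀ v k, g v = k + 1 → ∃ u, R u v ∧ g u = k) : f = g := by
  -- The disjunction is essential: a predecessor supplied by one grading is known to have small
  -- degree only in the other.
  have key : ∀ n : ℕ, ∀ v, f v ≤ n ∨ g v ≤ n → f v = g v := by
    intro n
    induction n with
    | zero =>
      rintro v (h | h)
      · rcases hgv : g v with _ | k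
        · omega
        · obtain ⟨u, hu, -⟩ := hg' v k hgv
          have := hf u v hu
          omega
      · rcases hfv : f v with _ | k
        · omega
        · obtain ⟨u, hu, -⟩ := hf' v k hfv
          have := hg u v hu
          omega
    | succ n ih =>
      intro v h
      have h1 : f v ≤ n + 1 → g v ≤ f v := by
        intro h
        rcases hgv : g v with _ | k
        · omega
        · obtain ⟨u, hu, huk⟩ := hg' v k hgv
          have := hf u v hu
          have := ih u (Or.inl (by omega))
          omega
      have h2 : g v ≤ n + 1 → f v ≤ g v := by
        intro h
        rcases hfv : f v with _ | k
        · omega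
        · obtain ⟨u, hu, huk⟩ := hf' v k hfv
          have := hg u v hu
          have := ih u (Or.inr (by omega))
          omega
      omega
  exact funext fun v => key (f v) v (Or.inl le_rfl)

end ChainCode
end LocalSym

/-! ### Existence of valid and normal codes -/

namespace LocalSym

open ChainCode

universe u

theorem exists_initial_segment (m : ℕ) (D : ℕ → Prop) (hD : ∀ i j, i < j → j < m → D j → D i) :
    ∃ p ≤ m, ∀ k < m, D k ↔ k < p := by
  classical
  -- The value m is the default when `D` holds along the whole chain.
  have hex : ∃ p, p = m ∨ ¬ D p := ⟨m, Or.inl rfl⟩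
  refine ⟨Nat.find hex, Nat.find_min' hex (Or.inl rfl), fun k hk => ⟨fun h => ?_, fun h => ?_⟩⟩
  · by_contra hlt
    rcases Nat.find_spec hex with h1 | h1
    · omega
    · rcases (not_lt.1 hlt).lt_or_eq with h2 | h2
      · exact h1 (hD _ _ h2 hk h)
      · exact h1 (h2 ▸ h)
  · by_contra hk'
    exact Nat.find_min hex h (Or.inr hk')

section

variable {P : Type u} [PartialOrder P]

theorem not_strictMono_of_layers {m : ℕ} (h : layers (Set.univ : Set P) = m) (f : ℕ → P)
    (hf : ∀ i j, i < j → j < m + 1 → f i < f j) : False := by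
  have hinj : Set.InjOn f (Set.Iio (m + 1)) := by
    intro i hi j hj hij
    rcases lt_trichotomy i j with h1 | h1 | h1
    · exact absurd hij (hf _ _ h1 hj).ne
    · exact h1
    · exact absurd hij (hf _ _ h1 hi).ne'
  have hc : IsChain (· ≤ ·) (f '' Set.Iio (m + 1)) := by
    rintro _ ⟨i, hi, rfl⟩ _ ⟨j, hj, rfl⟩ hne
    rcases lt_trichotomy i j with h1 | h1 | h1
    · exact Or.inl (hf _ _ h1 hj).le
    · exact absurd (congrArg f h1) hne
    · exact Or.inr (hf _ _ h1 hi).le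
  have h1 := Set.encard_le_chainHeight_of_isChain _ _ (Set.subset_univ _) hc
  change _ ≤ layers (Set.univ : Set P) at h1
  rw [hinj.encard_image, h, ← Finset.coe_Iio, Set.encard_coe_eq_coe_finsetCard, Nat.card_Iio] at h1
  have := Nat.cast_le.1 h1
  omega

theorem exists_chain_of_layers [Finite P] {m : ℕ} (h : layers (Set.univ : Set P) = m)
    (hcard : Nat.card P = m + 2) :
    ∃ (c : ℕ → P) (x y : P), (∀ i j, i < j → j < m → c i < c j) ∧ x ≠ y ∧
      (∀ k < m, c k ≠ x) ∧ ∀ k < m, c k ≠ y := by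
  classical
  obtain ⟨t, -, ht, hc⟩ := Set.exists_isChain_of_le_chainHeight (r := (· ≤ ·))
    (s := (Set.univ : Set P)) m (ge_of_eq (show layers (Set.univ : Set P) = m from h))
  have htf : t.Finite := Set.toFinite t
  let _ : LinearOrder t := hc.linearOrder
  let _ : Fintype t := htf.fintype
  have hct : Fintype.card t = m := by
    rw [Set.encard_eq_coe_toFinset_card, Set.toFinset_card] at ht
    exact_mod_cast ht
  let φ := monoEquivOfFin t hct
  have hcompl : 1 < tᶜ.ncard := by
    have h1 := Set.ncard_add_ncard_compl t
    rw [hcard, Set.ncard_eq_toFinset_card', Set.toFinset_card, hct] at h1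
    omega
  obtain ⟨x, y, hx, hy, hxy⟩ := (Set.one_lt_ncard_iff (Set.toFinite _)).1 hcompl
  refine ⟨fun k => if hk : k < m then φ ⟨k, hk⟩ else x, x, y, ?_, hxy, ?_, ?_⟩
  · intro i j hij hj
    simp only [hj, hij.trans hj, dif_pos]
    exact φ.strictMono (show (⟨i, _⟩ : Fin m) < ⟨j, _⟩ from hij)
  · intro k hk he
    simp only [hk, dif_pos] at he
    exact hx (he ▸ (φ ⟨k, hk⟩).2)
  · intro k hk he
    simp only [hk, dif_pos] at he
    exact hy (he ▸ (φ ⟨k, hk⟩).2)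

/-- If p = q, then x could be inserted between c_{p-1} and c_p, giving a chain of m + 1 elements;
hence p < q. -/
theorem exists_interval_of_layers {m : ℕ} (h : layers (Set.univ : Set P) = m)
    {c : ℕ → P} (hc : ∀ i j, i < j → j < m → c i < c j) {x : P} :
    ∃ p q, p < q ∧ q ≤ m ∧ (∀ k < m, c k < x ↔ k < p) ∧ ∀ k < m, x < c k ↔ q ≤ k := by
  obtain ⟨p, hp, hp'⟩ := exists_initial_segment m (fun k => c k < x)
    fun i j hij hj hjx => (hc i j hij hj).trans hjx
  obtain ⟨q, hq, hq'⟩ := exists_initial_segment m (fun k => ¬ x < c k)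
    fun i j hij hj hjx hi => hjx (hi.trans (hc i j hij hj))
  have hq'' : ∀ k < m, x < c k ↔ q ≤ k := fun k hk => by
    have := hq' k hk
    rw [← not_lt, ← this, not_not]
  have hpq : p ≤ q := by
    by_contra hlt
    exact lt_asymm ((hp' q (by omega)).2 (by omega)) ((hq'' q (by omega)).2 le_rfl)
  refine ⟨p, q, lt_of_le_of_ne hpq ?_, hq, hp', hq''⟩
  rintro rfl
  refine not_strictMono_of_layers h
    (fun k => if k < p then c k else if k = p then x else c (k - 1)) fun i j hij hj => ?_
  split_ifs
  · exact hc _ _ hij (by omega)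
  · exact (hp' _ (by omega)).2 (by omega)
  · exact hc _ _ (by omega) (by omega)
  · omega
  · omega
  · exact (hq'' _ (by omega)).2 (by omega)
  · omega
  · omega
  · exact hc _ _ (by omega) (by omega)

theorem exists_valid_code [Finite P] {m : ℕ} (h : layers (Set.univ : Set P) = m)
    (hcard : Nat.card P = m + 2) :
    ∃ C, Valid m C ∧ ∃ g : Fin (m + 2) ≃ P, ∀ u v, g u < g v ↔ ChainCode.Rel m C u v := by
  classical
  obtain ⟨c, x, y, hc, hxy, hcx, hcy, hyx⟩ : ∃ (c : ℕ → P) (x y : P),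
      (∀ i j, i < j → j < m → c i < c j) ∧ x ≠ y ∧ (∀ k < m, c k ≠ x) ∧ (∀ k < m, c k ≠ y) ∧
        ¬ y < x := by
    obtain ⟨c, x, y, hc, hxy, hcx, hcy⟩ := exists_chain_of_layers h hcard
    by_cases hyx : y < x
    · exact ⟨c, y, x, hc, hxy.symm, hcy, hcx, hyx.not_gt⟩
    · exact ⟨c, x, y, hc, hxy, hcx, hcy, hyx⟩
  obtain ⟨p, q, hpq, hq, hp, hq'⟩ := exists_interval_of_layers h hc (x := x)
  obtain ⟨r, s, hrs, hs, hr, hs'⟩ := exists_interval_of_layers h hc (x := y)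
  obtain ⟨e, he, he'⟩ : ∃ e : ℕ, e ≤ 1 ∧ (x < y ↔ e = 1) := by
    by_cases hlt : x < y
    · exact ⟨1, le_rfl, by simpa⟩
    · exact ⟨0, by omega, by simpa⟩
  have hval : Valid m ⟨p, q, r, s, e⟩ := by
    refine ⟨hpq, hq, hrs, hs, he, fun h0 => ⟨?_, ?_⟩, fun h1 => ⟨?_, ?_, ?_⟩⟩
    · by_contra hlt
      simp only at hlt h0
      have := he'.1 (((hq' q (by omega)).2 le_rfl).trans ((hr q (by omega)).2 (by omega)))
      omega
    · by_contra hlt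
      simp only at hlt
      exact hyx (((hs' s (by omega)).2 le_rfl).trans ((hp s (by omega)).2 (by omega)))
    · by_contra hlt
      simp only at hlt h1
      have := (hr r (by omega)).1 (((hp r (by omega)).2 (by omega)).trans (he'.2 h1))
      omega
    · by_contra hlt
      simp only at hlt h1
      have := (hq' s (by omega)).1 ((he'.2 h1).trans ((hs' s (by omega)).2 le_rfl))
      omega
    · by_contra hlt
      simp only at hlt h1
      -- If x < y and s ≤ p + 1, replacing c_p by the two elements x < y gives a chain of m + 1
      -- elements.
      refine not_strictMono_of_layers h (fun k => if k < p then c k else if k = p then x else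
        if k = p + 1 then y else c (k - 1)) fun i j hij hj => ?_
      have hxy' := he'.2 h1
      split_ifs <;> first
        | omega
        | exact hc _ _ (by omega) (by omega)
        | exact (hp _ (by omega)).2 (by omega)
        | exact ((hp _ (by omega)).2 (by omega)).trans hxy'
        | exact hxy'
        | exact hxy'.trans ((hs' _ (by omega)).2 (by omega))
        | exact (hs' _ (by omega)).2 (by omega)
  let g : Fin (m + 2) → P := fun u => if u.1 < m then c u else if u.1 = m then x else y
  have hg : ∀ u v, g u < g v ↔ ChainCode.Rel m ⟨p, q, r, s, e⟩ u v := by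
    rintro ⟨u, hu⟩ ⟨v, hv⟩
    simp only [g, ChainCode.Rel]
    split_ifs
    · have : c u < c v ↔ u < v := by
        refine ⟨fun hlt => ?_, fun hlt => hc _ _ hlt (by omega)⟩
        by_contra hle
        rcases (not_lt.1 hle).lt_or_eq with h2 | h2
        · exact lt_asymm hlt (hc _ _ h2 (by omega))
        · exact hlt.ne (congrArg c h2.symm)
      rw [this]
      omega
    · rw [hp u (by omega)]
      omega
    · rw [hr u (by omega)]
      omega
    · rw [hq' v (by omega)]
      omega
    · simp only [lt_irrefl, false_iff]
      omega
    · rw [he']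
      omega
    · rw [hs' v (by omega)]
      omega
    · simp only [hyx, false_iff]
      omega
    · simp only [lt_irrefl, false_iff]
      omega
  have hinj : Function.Injective g := by
    rintro ⟨u, hu⟩ ⟨v, hv⟩ huv
    ext
    simp only [g] at huv ⊢
    split_ifs at huv with h1 h2 h3 h4 h5 h6 h7
    · by_contra hne
      rcases Nat.lt_or_gt_of_ne hne with h2 | h2
      · exact (hc _ _ h2 (by omega)).ne huv
      · exact (hc _ _ h2 (by omega)).ne' huv
    · exact absurd huv (hcx _ h1)
    · exact absurd huv (hcy _ h1)
    · exact absurd huv.symm (hcx _ (by omega))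
    · omega
    · exact absurd huv hxy
    · exact absurd huv.symm (hcy _ (by omega))
    · exact absurd huv.symm hxy
    · omega
  have hbij : Function.Bijective g := by
    rw [Nat.bijective_iff_injective_and_card]
    exact ⟨hinj, by rw [hcard, Nat.card_eq_fintype_card, Fintype.card_fin]⟩
  exact ⟨_, hval, Equiv.ofBijective g hbij, hg⟩

end

namespace ChainCode

variable {m : ℕ} {C : ChainCode}

theorem coe_swap (a b u : Fin (m + 2)) :
    ((Equiv.swap a b u : Fin (m + 2)) : ℕ) = if u.1 = a then b.1 else if u.1 = b then a else u := by
  rw [Equiv.swap_apply_def]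
  simp only [Fin.ext_iff]
  split_ifs <;> rfl

/-- For e = 0, exchanging the names of x and y suffices. For e = 1, a valid code fails to be normal
only if x and c_p, or y and c_r, compare alike with the other chain elements; putting x or y into
the chain instead yields a normal code with e = 0. -/
theorem exists_normal (h : Valid m C) : ∃ C', Normal m C' ∧
    ∃ g : Fin (m + 2) ≃ Fin (m + 2), ∀ u v, Rel m C (g u) (g v) ↔ Rel m C' u v := by
  obtain ⟨p, q, r, s, e⟩ := C
  obtain ⟨h1, h2, h3, h4, h5, h6, h7⟩ := h
  dsimp only at h1 h2 h3 h4 h5 h6 h7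
  by_cases hn : Normal m ⟨p, q, r, s, e⟩
  · exact ⟨_, hn, Equiv.refl _, fun u v => Iff.rfl⟩
  have he : e = 0 ∨ e = 1 := by omega
  -- A name for 0, the value of `e` in the new codes below.
  obtain ⟨z, hz⟩ : ∃ z, z = 0 := ⟨0, rfl⟩
  rcases he with he | he
  · replace h6 := h6 he
    clear h7
    refine ⟨⟨r, s, p, q, e⟩, ?_, Equiv.swap ⟨m, by omega⟩ ⟨m + 1, by omega⟩, fun u v => ?_⟩
    · by_contra hn'
      refine hn ?_
      have h8 : p < r ∨ (p = r ∧ q ≤ s) := by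
        by_contra hc
        exact hn' ⟨by simp only; omega, by simp only; omega, by simp only; omega,
          by simp only; omega, by simp only; omega, by simp only; omega⟩
      exact ⟨by simp only; omega, by simp only; omega, by simp only; omega,
          by simp only; omega, by simp only; omega, by simp only; omega⟩
    · have := u.2
      have := v.2
      simp only [coe_swap, ChainCode.Rel]
      split_ifs <;> constructor <;> rintro (h | h | h | h | h | h) <;> omega
  · replace h7 := h7 he
    clear h6
    have h8 : (p = r ∧ q = p + 1) ∨ (p < r ∧ q = r + 1 ∧ s = r + 1) := by
      by_contra hc
      exact hn ⟨by simp only; omega, by simp only; omega, by simp only; omega,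
          by simp only; omega, by simp only; omega, by simp only; omega⟩
    rcases h8 with ⟨rfl, rfl⟩ | ⟨h8, rfl, rfl⟩
    · refine ⟨⟨p, p + 1, p + 1, s, z⟩, ⟨by simp only; omega, by simp only; omega,
        by simp only; omega, by simp only; omega, by simp only; omega, by simp only; omega⟩,
        Equiv.swap ⟨m, by omega⟩ ⟨p, by omega⟩, fun u v => ?_⟩
      have := u.2
      have := v.2
      simp only [coe_swap, ChainCode.Rel]
      split_ifs <;> constructor <;> rintro (h | h | h | h | h | h) <;> omega
    · refine ⟨⟨p, r, r, r + 1, z⟩, ⟨by simp only; omega, by simp only; omega,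
        by simp only; omega, by simp only; omega, by simp only; omega, by simp only; omega⟩,
        Equiv.swap ⟨m + 1, by omega⟩ ⟨r, by omega⟩, fun u v => ?_⟩
      have := u.2
      have := v.2
      simp only [coe_swap, ChainCode.Rel]
      split_ifs <;> constructor <;> rintro (h | h | h | h | h | h) <;> omega

end ChainCode
end LocalSym

/-! ### Uniqueness of normal codes, and rigidity -/

namespace LocalSym
namespace ChainCode

variable {m : ℕ} {C C' : ChainCode}

theorem rel_chain {u v : ℕ} (hu : u < m) (hv : v < m) :
    Rel m C u v ↔ u < v := by
  unfold Rel
  omega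

theorem rel_fst_left {v : ℕ} (hv : v < m) : Rel m C m v ↔ C.q ≤ v := by
  unfold Rel
  omega

theorem rel_snd_left {v : ℕ} (hv : v < m) : Rel m C (m + 1) v ↔ C.s ≤ v := by
  unfold Rel
  omega

theorem rel_snd_right {u : ℕ} (hu : u < m) : Rel m C u (m + 1) ↔ u < C.r := by
  unfold Rel
  omega

theorem rel_fst_snd (h : Normal m C) : Rel m C m (m + 1) ↔ C.e = 1 := by
  have := h.r_lt_s
  have := h.s_le
  unfold Rel
  omega

theorem sum_height (F : ℕ → ℕ) : ∑ u : Fin (m + 2), F (height m C u) =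
    ∑ k ∈ Finset.range m, F k + F C.p + F (height m C (m + 1)) := by
  rw [Fin.sum_univ_eq_sum_range (fun u => F (height m C u)), Finset.sum_range_succ,
    Finset.sum_range_succ, height_self]
  congr 2
  exact Finset.sum_congr rfl fun k hk => by rw [height_of_lt (Finset.mem_range.1 hk)]

theorem height_apply_eq (h : Normal m C) (h' : Normal m C') (f : Fin (m + 2) ≃ Fin (m + 2))
    (hf : ∀ u v : Fin (m + 2), Rel m C u v ↔ Rel m C' (f u) (f v)) (u : Fin (m + 2)) :
    height m C' (f u) = height m C u := by
  refine congrFun (f := fun u : Fin (m + 2) => height m C' (f u))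
    (g := fun u : Fin (m + 2) => height m C u)
    (grading_unique (R := fun u v : Fin (m + 2) => Rel m C u v) ?_ ?_ ?_ ?_) u
  · exact fun u v huv => height_strictMono h' ((hf u v).1 huv)
  · exact fun u v huv => height_strictMono h huv
  · intro v k hk
    obtain ⟨w, hw, hr, hwk⟩ := exists_rel_of_height_eq h' (f v).2 hk
    refine ⟨f.symm ⟨w, hw⟩, (hf _ _).2 ?_, ?_⟩
    · simpa using hr
    · simpa using hwk
  · intro v k hk
    obtain ⟨w, hw, hr, hwk⟩ := exists_rel_of_height_eq h v.2 hk
    exact ⟨⟨w, hw⟩, hr, hwk⟩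

/-- Sum a function F over all heights: the chain contributes the same in both posets, so F(p) +
F(height of y) is invariant. Taking F(x) = x and F(x) = x² determines the unordered pair, and p is
the smaller entry. -/
theorem height_params_eq (h : Normal m C) (h' : Normal m C') (f : Fin (m + 2) ≃ Fin (m + 2))
    (hf : ∀ u v : Fin (m + 2), Rel m C u v ↔ Rel m C' (f u) (f v)) :
    C.p = C'.p ∧ height m C (m + 1) = height m C' (m + 1) := by
  have key : ∀ F : ℕ → ℕ, F C.p + F (height m C (m + 1)) =
      F C'.p + F (height m C' (m + 1)) := by
    intro F
    have h1 : ∑ u : Fin (m + 2), F (height m C' u) = ∑ u : Fin (m + 2), F (height m C u) := by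
      rw [← Equiv.sum_comp f]
      exact Finset.sum_congr rfl fun u _ => by rw [height_apply_eq h h' f hf]
    rw [sum_height, sum_height] at h1
    omega
  have h1 := key id
  have h2 := key (fun x => x * x)
  have h3 : C.p ≤ height m C (m + 1) := by
    have := h.p_le_r
    rw [height_succ]
    split_ifs <;> omega
  have h4 : C'.p ≤ height m C' (m + 1) := by
    have := h'.p_le_r
    rw [height_succ]
    split_ifs <;> omega
  simp only [id] at h1 h2
  obtain ⟨a, ha⟩ := Nat.exists_eq_add_of_le h3
  obtain ⟨b, hb⟩ := Nat.exists_eq_add_of_le h4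
  rw [ha, hb] at h1 h2
  -- With a and b the differences of the two heights, use 2(p² + (p + a)²) = (2p + a)² + a².
  have h5 : a = b := by
    have : (a : ℤ) * a = b * b := by
      zify at h1 h2
      nlinarith
    have h6 : a * a = b * b := by exact_mod_cast this
    exact Nat.mul_self_inj.1 h6
  omega

/-- An isomorphism of posets with normal codes, as a map on natural numbers. -/
structure IsIso (m : ℕ) (C C' : ChainCode) (g : ℕ → ℕ) : Prop where
  lt : ∀ u < m + 2, g u < m + 2
  inj : ∀ u < m + 2, ∀ v < m + 2, g u = g v → u = v
  rel : ∀ u < m + 2, ∀ v < m + 2, Rel m C u v ↔ Rel m C' (g u) (g v)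
  height : ∀ u < m + 2, height m C' (g u) = height m C u
  p_eq : C.p = C'.p
  height_eq : ChainCode.height m C (m + 1) = ChainCode.height m C' (m + 1)

theorem IsIso.of_equiv (h : Normal m C) (h' : Normal m C') (f : Fin (m + 2) ≃ Fin (m + 2))
    (hf : ∀ u v : Fin (m + 2), Rel m C u v ↔ Rel m C' (f u) (f v)) :
    IsIso m C C' (fun u => if hu : u < m + 2 then f ⟨u, hu⟩ else u) := by
  refine ⟨fun u hu => ?_, fun u hu v hv huv => ?_, fun u hu v hv => ?_, fun u hu => ?_,
    (height_params_eq h h' f hf).1, (height_params_eq h h' f hf).2⟩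
  · simp only [hu, dif_pos]
    exact Fin.is_lt _
  · simp only [hu, hv, dif_pos] at huv
    have := f.injective (Fin.ext huv)
    simpa using this
  · simp only [hu, hv, dif_pos]
    exact hf ⟨u, hu⟩ ⟨v, hv⟩
  · simp only [hu, dif_pos]
    exact height_apply_eq h h' f hf ⟨u, hu⟩

/-- A height different from those of x and y is attained by a single element, which lies on the
chain. -/
theorem IsIso.apply_chain {g : ℕ → ℕ} (hg : IsIso m C C' g) {u : ℕ} (hu : u < m)
    (h1 : u ≠ C.p) (h2 : u ≠ ChainCode.height m C (m + 1)) : g u = u := by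
  have h3 := hg.lt u (by omega)
  have h4 := hg.height u (by omega)
  rw [height_of_lt hu] at h4
  have h5 : g u < m ∨ g u = m ∨ g u = m + 1 := by omega
  rcases h5 with h5 | h5 | h5
  · rwa [height_of_lt h5] at h4
  · rw [h5, height_self, ← hg.p_eq] at h4
    omega
  · rw [h5, ← hg.height_eq] at h4
    omega

/-- If a ≠ b, the smaller one is a chain index beyond i that separates them. Only indices beyond i
are tested, since c_i itself may be moved. -/
theorem threshold_eq {m i a b : ℕ} (ha : i < a) (hb : i < b) (ha' : a ≤ m) (hb' : b ≤ m)
    (h : ∀ k < m, i < k → (a ≤ k ↔ b ≤ k)) : a = b := by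
  by_contra hne
  have := h (min a b) (by omega) (by omega)
  omega

/-- Here c_p, x, y all have height p, are pairwise incomparable and have the same elements below.
They differ only in the thresholds p + 1, q, s above them. An isomorphism permutes these thresholds,
and q ≤ s then fixes them; if they are distinct, the permutation is trivial. -/
theorem IsIso.eq_of_height_eq {g : ℕ → ℕ} (h : Normal m C) (h' : Normal m C')
    (hg : IsIso m C C' g) (hp : C.p = ChainCode.height m C (m + 1)) :
    C = C' ∧ (Rigid C → ∀ u < m + 2, g u = u) := by
  have hK : ∀ k < m, k ≠ C.p → g k = k := fun k hk hkp => hg.apply_chain hk hkp (by omega)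
  have hp' : C'.p = ChainCode.height m C' (m + 1) := by rw [← hg.p_eq, ← hg.height_eq, hp]
  have hpp := hg.p_eq
  have hv := hg.height
  have c1 := h.cases
  have c2 := h'.cases
  have b1 := h.p_lt_q
  have b2 := h.q_le
  have b3 := h.r_lt_s
  have b4 := h.s_le
  have b1' := h'.p_lt_q
  have b2' := h'.q_le
  have b3' := h'.r_lt_s
  have b4' := h'.s_le
  have e1 : C.e = 0 ∧ C.p = C.r ∧ C.q ≤ C.s := by
    rw [height_succ] at hp
    split_ifs at hp <;> omega
  have e2 : C'.e = 0 ∧ C'.p = C'.r ∧ C'.q ≤ C'.s := by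
    rw [height_succ] at hp'
    split_ifs at hp' <;> omega
  have hpm : C.p < m := by omega
  have val : ∀ u < m + 2, ChainCode.height m C u = C.p → g u = C.p ∨ g u = m ∨ g u = m + 1 := by
    intro u hu hup
    have h3 := hg.lt u hu
    have h4 := hg.height u hu
    by_cases h5 : g u < m
    · rw [height_of_lt h5] at h4
      omega
    · omega
  have v1 := val C.p (by omega) (height_of_lt hpm)
  have v2 := val m (by omega) height_self
  have v3 := val (m + 1) (by omega) hp.symm
  have n1 := hg.inj C.p (by omega) m (by omega)
  have n2 := hg.inj C.p (by omega) (m + 1) (by omega)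
  have n3 := hg.inj m (by omega) (m + 1) (by omega)
  have K : ∀ k < m, k ≠ C.p → (C.p < k ↔ Rel m C' (g C.p) k) ∧ (C.q ≤ k ↔ Rel m C' (g m) k) ∧
      (C.s ≤ k ↔ Rel m C' (g (m + 1)) k) := by
    intro k hk hkp
    have r1 := hg.rel C.p (by omega) k (by omega)
    have r2 := hg.rel m (by omega) k (by omega)
    have r3 := hg.rel (m + 1) (by omega) k (by omega)
    rw [hK k hk hkp] at r1 r2 r3
    rw [rel_chain hpm hk] at r1
    rw [rel_fst_left hk] at r2
    rw [rel_snd_left hk] at r3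
    exact ⟨r1, r2, r3⟩
  have K' : ∀ k < m, (Rel m C' C.p k ↔ C.p < k) ∧ (Rel m C' m k ↔ C'.q ≤ k) ∧
      (Rel m C' (m + 1) k ↔ C'.s ≤ k) :=
    fun k hk => ⟨rel_chain hpm hk, rel_fst_left hk, rel_snd_left hk⟩
  have v : (g C.p = C.p ∧ g m = m ∧ g (m + 1) = m + 1) ∨
      (g C.p = C.p ∧ g m = m + 1 ∧ g (m + 1) = m) ∨
      (g C.p = m ∧ g m = C.p ∧ g (m + 1) = m + 1) ∨
      (g C.p = m ∧ g m = m + 1 ∧ g (m + 1) = C.p) ∨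
      (g C.p = m + 1 ∧ g m = C.p ∧ g (m + 1) = m) ∨
      (g C.p = m + 1 ∧ g m = m ∧ g (m + 1) = C.p) := by
    clear * - v1 v2 v3 n1 n2 n3 hpm
    rcases v1 with v1 | v1 | v1 <;> rcases v2 with v2 | v2 | v2 <;>
      rcases v3 with v3 | v3 | v3 <;> first
        | exact Or.inl ⟨v1, v2, v3⟩
        | exact Or.inr (Or.inl ⟨v1, v2, v3⟩)
        | exact Or.inr (Or.inr (Or.inl ⟨v1, v2, v3⟩))
        | exact Or.inr (Or.inr (Or.inr (Or.inl ⟨v1, v2, v3⟩)))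
        | exact Or.inr (Or.inr (Or.inr (Or.inr (Or.inl ⟨v1, v2, v3⟩))))
        | exact Or.inr (Or.inr (Or.inr (Or.inr (Or.inr ⟨v1, v2, v3⟩))))
        | omega
  have t1 : C.p < C'.q := by omega
  have t2 : C.p < C'.s := by omega
  have t3 : C.p < C.q := by omega
  have t4 : C.p < C.s := by omega
  -- The six permutations of c_p, x, y, each turned into equations between thresholds.
  have t : (g C.p = C.p ∧ g m = m ∧ g (m + 1) = m + 1 ∧ C.q = C'.q ∧ C.s = C'.s) ∨
      (C.q = C'.s ∧ C.s = C'.q) ∨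
      (C.p + 1 = C'.q ∧ C.q = C.p + 1 ∧ C.s = C'.s) ∨
      (C.p + 1 = C'.q ∧ C.q = C'.s ∧ C.s = C.p + 1) ∨
      (C.p + 1 = C'.s ∧ C.q = C.p + 1 ∧ C.s = C'.q) ∨
      (C.p + 1 = C'.s ∧ C.q = C'.q ∧ C.s = C.p + 1) := by
    clear c1 c2 e1 e2 val v1 v2 v3 n1 n2 n3
    rcases v with ⟨g1, g2, g3⟩ | ⟨g1, g2, g3⟩ | ⟨g1, g2, g3⟩ | ⟨g1, g2, g3⟩ | ⟨g1, g2, g3⟩ |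
        ⟨g1, g2, g3⟩ <;> rw [g1, g2, g3] at K
    · refine Or.inl ⟨g1, g2, g3, ?_, ?_⟩ <;> refine threshold_eq ‹_› ‹_› ‹_› ‹_› fun k hk hkp => ?_
      · exact (K k hk hkp.ne').2.1.trans (K' k hk).2.1
      · exact (K k hk hkp.ne').2.2.trans (K' k hk).2.2
    · refine Or.inr (Or.inl ⟨?_, ?_⟩) <;>
        refine threshold_eq ‹_› ‹_› ‹_› ‹_› fun k hk hkp => ?_
      · exact (K k hk hkp.ne').2.1.trans (K' k hk).2.2
      · exact (K k hk hkp.ne').2.2.trans (K' k hk).2.1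
    · refine Or.inr (Or.inr (Or.inl ⟨?_, ?_, ?_⟩)) <;>
        refine threshold_eq (m := m) (i := C.p) (by omega) (by omega) (by omega) (by omega) fun k hk hkp => ?_
      · exact (K k hk hkp.ne').1.trans (K' k hk).2.1
      · exact (K k hk hkp.ne').2.1.trans (K' k hk).1
      · exact (K k hk hkp.ne').2.2.trans (K' k hk).2.2
    · refine Or.inr (Or.inr (Or.inr (Or.inl ⟨?_, ?_, ?_⟩))) <;>
        refine threshold_eq (m := m) (i := C.p) (by omega) (by omega) (by omega) (by omega) fun k hk hkp => ?_
      · exact (K k hk hkp.ne').1.trans (K' k hk).2.1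
      · exact (K k hk hkp.ne').2.1.trans (K' k hk).2.2
      · exact (K k hk hkp.ne').2.2.trans (K' k hk).1
    · refine Or.inr (Or.inr (Or.inr (Or.inr (Or.inl ⟨?_, ?_, ?_⟩)))) <;>
        refine threshold_eq (m := m) (i := C.p) (by omega) (by omega) (by omega) (by omega) fun k hk hkp => ?_
      · exact (K k hk hkp.ne').1.trans (K' k hk).2.2
      · exact (K k hk hkp.ne').2.1.trans (K' k hk).1
      · exact (K k hk hkp.ne').2.2.trans (K' k hk).2.1
    · refine Or.inr (Or.inr (Or.inr (Or.inr (Or.inr ⟨?_, ?_, ?_⟩)))) <;>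
        refine threshold_eq (m := m) (i := C.p) (by omega) (by omega) (by omega) (by omega) fun k hk hkp => ?_
      · exact (K k hk hkp.ne').1.trans (K' k hk).2.2
      · exact (K k hk hkp.ne').2.1.trans (K' k hk).2.1
      · exact (K k hk hkp.ne').2.2.trans (K' k hk).1
  clear K K' v val v1 v2 v3 n1 n2 n3 hv c1 c2
  refine ⟨ChainCode.ext hpp (by omega) (by omega) (by omega) (by omega), fun hR u hu => ?_⟩
  have hR' : C.p + 1 < C.q ∧ C.q < C.s := by
    unfold Rigid at hR
    omega
  have hid : g C.p = C.p ∧ g m = m ∧ g (m + 1) = m + 1 := by omega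
  have hu' : u = C.p ∨ u = m ∨ u = m + 1 ∨ (u < m ∧ u ≠ C.p) := by omega
  rcases hu' with rfl | rfl | rfl | ⟨hu1, hu2⟩
  · exact hid.1
  · exact hid.2.1
  · exact hid.2.2
  · exact hK u hu1 hu2

/-- With j the height of y, the only repeated heights are p, shared by c_p and x, and j, shared by
c_j and y. Each pair is fixed or exchanged. -/
theorem IsIso.cases_of_height_lt {g : ℕ → ℕ} (h : Normal m C)
    (hg : IsIso m C C' g) {j : ℕ} (hj : ChainCode.height m C (m + 1) = j) (hp : C.p < j) :
    (g C.p = C.p ∧ g m = m ∨ g C.p = m ∧ g m = C.p) ∧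
      (g j = j ∧ g (m + 1) = m + 1 ∨ g j = m + 1 ∧ g (m + 1) = j) := by
  have hj' : ChainCode.height m C' (m + 1) = j := by rw [← hg.height_eq, hj]
  have hjm : j < m := hj ▸ height_lt h _
  have hpp := hg.p_eq
  have val : ∀ u < m + 2, ChainCode.height m C u = C.p → g u = C.p ∨ g u = m := by
    intro u hu hup
    have h3 := hg.lt u hu
    have h4 := hg.height u hu
    have h5 : g u < m ∨ g u = m ∨ g u = m + 1 := by omega
    rcases h5 with h5 | h5 | h5
    · rw [height_of_lt h5] at h4
      omega
    · exact Or.inr h5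
    · rw [h5] at h4
      omega
  have val' : ∀ u < m + 2, ChainCode.height m C u = j → g u = j ∨ g u = m + 1 := by
    intro u hu hup
    have h3 := hg.lt u hu
    have h4 := hg.height u hu
    have h5 : g u < m ∨ g u = m ∨ g u = m + 1 := by omega
    rcases h5 with h5 | h5 | h5
    · rw [height_of_lt h5] at h4
      omega
    · rw [h5, height_self] at h4
      omega
    · exact Or.inr h5
  have v1 := val C.p (by omega) (height_of_lt (by omega))
  have v2 := val m (by omega) height_self
  have v3 := val' j (by omega) (height_of_lt hjm)
  have v4 := val' (m + 1) (by omega) hj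
  have n1 := hg.inj C.p (by omega) m (by omega)
  have n2 := hg.inj j (by omega) (m + 1) (by omega)
  omega

/-- The comparisons of the elements outside the chain, and of those of the same heights, with the
other elements of the chain. -/
structure IsIso.Compat (m : ℕ) (C C' : ChainCode) (g : ℕ → ℕ) (j : ℕ) : Prop where
  chain : ∀ k < m, k ≠ C.p → k ≠ j →
    (C.p < k ↔ Rel m C' (g C.p) k) ∧ (C.q ≤ k ↔ Rel m C' (g m) k) ∧
    (j < k ↔ Rel m C' (g j) k) ∧ (C.s ≤ k ↔ Rel m C' (g (m + 1)) k)
  p_j : C.p < j ↔ Rel m C' (g C.p) (g j)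
  p_snd : C.p < C.r ↔ Rel m C' (g C.p) (g (m + 1))
  fst_j : C.q ≤ j ↔ Rel m C' (g m) (g j)
  fst_snd : C.e = 1 ↔ Rel m C' (g m) (g (m + 1))

theorem IsIso.compat {g : ℕ → ℕ} (h : Normal m C)
    (hg : IsIso m C C' g) {j : ℕ} (hj : ChainCode.height m C (m + 1) = j) (hp : C.p < j) :
    IsIso.Compat m C C' g j := by
  have hjm : j < m := hj ▸ height_lt h _
  have hpm : C.p < m := by omega
  refine ⟨fun k hk hkp hkj => ?_, ?_, ?_, ?_, ?_⟩
  · have r1 := hg.rel C.p (by omega) k (by omega)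
    have r2 := hg.rel m (by omega) k (by omega)
    have r3 := hg.rel (m + 1) (by omega) k (by omega)
    have r4 := hg.rel j (by omega) k (by omega)
    rw [hg.apply_chain hk hkp (by omega)] at r1 r2 r3 r4
    rw [rel_chain hpm hk] at r1
    rw [rel_fst_left hk] at r2
    rw [rel_snd_left hk] at r3
    rw [rel_chain hjm hk] at r4
    exact ⟨r1, r2, r4, r3⟩
  · rw [← hg.rel _ (by omega) _ (by omega), rel_chain hpm hjm]
  · rw [← hg.rel _ (by omega) _ (by omega), rel_snd_right hpm]
  · rw [← hg.rel _ (by omega) _ (by omega), rel_fst_left hjm]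
  · rw [← hg.rel _ (by omega) _ (by omega), rel_fst_snd h]

/-- The arithmetic content of the four cases for an isomorphism; `I` is what is known in the case
of the identity. -/
def Matches (m : ℕ) (C C' : ChainCode) (j : ℕ) (I : Prop) : Prop :=
  (I ∧ (∀ k, k < m ∧ k ≠ C.p ∧ k ≠ j → (C.q ≤ k ↔ C'.q ≤ k) ∧ (C.s ≤ k ↔ C'.s ≤ k)) ∧
    (C.p < C.r ↔ C.p < C'.r) ∧ (C.q ≤ j ↔ C'.q ≤ j) ∧ (C.e = 1 ↔ C'.e = 1)) ∨
  ((∀ k, k < m ∧ k ≠ C.p ∧ k ≠ j →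
      (C.q ≤ k ↔ C'.q ≤ k) ∧ (j < k ↔ C'.s ≤ k) ∧ (C.s ≤ k ↔ j < k)) ∧
    C.p < C'.r ∧ C.p < C.r ∧ (C.q ≤ j ↔ C'.e = 1) ∧ (C.e = 1 ↔ C'.q ≤ j)) ∨
  ((∀ k, k < m ∧ k ≠ C.p ∧ k ≠ j →
      (C.s ≤ k ↔ C'.s ≤ k) ∧ (C.p < k ↔ C'.q ≤ k) ∧ (C.q ≤ k ↔ C.p < k)) ∧
    C'.q ≤ j ∧ C.q ≤ j ∧ (C.p < C.r ↔ C'.e = 1) ∧ (C.e = 1 ↔ C.p < C'.r)) ∨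
  ((∀ k, k < m ∧ k ≠ C.p ∧ k ≠ j → (j < k ↔ C'.s ≤ k) ∧ (C.s ≤ k ↔ j < k) ∧
      (C.p < k ↔ C'.q ≤ k) ∧ (C.q ≤ k ↔ C.p < k)) ∧
    C.e = 1 ∧ C'.e = 1 ∧ (C.p < C.r ↔ C'.q ≤ j) ∧ (C.q ≤ j ↔ C.p < C'.r))

theorem IsIso.matches {g : ℕ → ℕ} (h : Normal m C) (h' : Normal m C')
    (hg : IsIso m C C' g) {j : ℕ} (hj : ChainCode.height m C (m + 1) = j) (hp : C.p < j) :
    Matches m C C' j (g C.p = C.p ∧ g m = m ∧ g j = j ∧ g (m + 1) = m + 1) := by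
  have hjm : j < m := hj ▸ height_lt h _
  have hpm : C.p < m := by omega
  have v := hg.cases_of_height_lt h hj hp
  obtain ⟨K, a1, a2, a3, a4⟩ := hg.compat h hj hp
  have b1 : Rel m C' C.p j ↔ C.p < j := rel_chain hpm hjm
  have b2 : Rel m C' C.p (m + 1) ↔ C.p < C'.r := rel_snd_right hpm
  have b3 : Rel m C' m j ↔ C'.q ≤ j := rel_fst_left hjm
  have b4 := rel_fst_snd h'
  have K' : ∀ k < m, (Rel m C' C.p k ↔ C.p < k) ∧ (Rel m C' m k ↔ C'.q ≤ k) ∧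
      (Rel m C' j k ↔ j < k) ∧ (Rel m C' (m + 1) k ↔ C'.s ≤ k) :=
    fun k hk => ⟨rel_chain hpm hk, rel_fst_left hk, rel_chain hjm hk, rel_snd_left hk⟩
  rcases v with ⟨⟨g1, g2⟩ | ⟨g1, g2⟩, ⟨g3, g4⟩ | ⟨g3, g4⟩⟩ <;>
    rw [g1, g3] at a1 <;> rw [g1, g4] at a2 <;> rw [g2, g3] at a3 <;> rw [g2, g4] at a4 <;>
    rw [g1, g2, g3, g4] at K
  · refine Or.inl ⟨⟨g1, g2, g3, g4⟩, fun k hk => ?_, a2.trans b2, a3.trans b3, a4.trans b4⟩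
    obtain ⟨k1, k2, k3, k4⟩ := K k hk.1 hk.2.1 hk.2.2
    obtain ⟨k1', k2', k3', k4'⟩ := K' k hk.1
    exact ⟨k2.trans k2', k4.trans k4'⟩
  · refine Or.inr (Or.inl ⟨fun k hk => ?_, b2.1 (a1.1 hp), a2.2 (b1.2 hp), a3.trans b4,
      a4.trans b3⟩)
    obtain ⟨k1, k2, k3, k4⟩ := K k hk.1 hk.2.1 hk.2.2
    obtain ⟨k1', k2', k3', k4'⟩ := K' k hk.1
    exact ⟨k2.trans k2', k3.trans k4', k4.trans k3'⟩
  · refine Or.inr (Or.inr (Or.inl ⟨fun k hk => ?_, b3.1 (a1.1 hp), a3.2 (b1.2 hp), a2.trans b4,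
      a4.trans b2⟩))
    obtain ⟨k1, k2, k3, k4⟩ := K k hk.1 hk.2.1 hk.2.2
    obtain ⟨k1', k2', k3', k4'⟩ := K' k hk.1
    exact ⟨k4.trans k4', k1.trans k2', k2.trans k1'⟩
  · refine Or.inr (Or.inr (Or.inr ⟨fun k hk => ?_, a4.2 (b1.2 hp), b4.1 (a1.1 hp), a2.trans b3,
      a3.trans b2⟩))
    obtain ⟨k1, k2, k3, k4⟩ := K k hk.1 hk.2.1 hk.2.2
    obtain ⟨k1', k2', k3', k4'⟩ := K' k hk.1
    exact ⟨k3.trans k4', k4.trans k3', k1.trans k2', k2.trans k1'⟩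

/-- Since c_j may be moved, the comparison at j has to come from a separate source. -/
theorem threshold_eq' {m i j a b : ℕ} (ha : i < a) (hb : i < b) (ha' : a ≤ m) (hb' : b ≤ m)
    (h : ∀ k, k < m → i < k → k ≠ j → (a ≤ k ↔ b ≤ k)) (hj : a ≤ j ↔ b ≤ j) : a = b := by
  refine threshold_eq ha hb ha' hb' fun k hk hi => ?_
  by_cases hkj : k = j
  · rwa [hkj]
  · exact h k hk hi hkj

/-- Exchanging c_j and y forces s = s' = j + 1; exchanging only c_p and x forces q = q' = p + 1.
Normality then leaves only C = C', and each of the three nontrivial cases contradicts rigidity. -/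
theorem Matches.eq {j : ℕ} {I : Prop} (h : Normal m C) (h' : Normal m C') (hpp : C.p = C'.p)
    (hp : C.p < j) (hjm : j < m)
    (e1 : (C.p < C.r ∧ C.r = j) ∨ (C.e = 1 ∧ C.p = C.r ∧ C.p + 1 = j))
    (e2 : (C'.p < C'.r ∧ C'.r = j) ∨ (C'.e = 1 ∧ C'.p = C'.r ∧ C'.p + 1 = j))
    (hM : Matches m C C' j I) : C = C' ∧ (Rigid C → I) := by
  have b1 := h.p_lt_q
  have b2 := h.q_le
  have b3 := h.r_lt_s
  have b4 := h.s_le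
  have c1 := h.cases
  have b1' := h'.p_lt_q
  have b2' := h'.q_le
  have b3' := h'.r_lt_s
  have b4' := h'.s_le
  have c2 := h'.cases
  have s1 : j < C.s := by omega
  have s2 : j < C'.s := by omega
  obtain ⟨p, q, r, s, e⟩ := C
  obtain ⟨p', q', r', s', e'⟩ := C'
  unfold Matches at hM
  unfold Rigid
  simp only at *
  subst hpp
  suffices (q = q' ∧ r = r' ∧ s = s' ∧ e = e') ∧ ((e = 0 ∧ p = r ∧ p + 1 < q ∧ q < s) ∨
      (e = 0 ∧ p < r ∧ (q = r ∨ r + 1 < s)) ∨ (e = 1 ∧ p = r ∧ p + 2 < s) ∨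
      (e = 1 ∧ p < r ∧ (r < q ∨ (p + 1 < q ∧ r + 1 < s))) → I) by
    obtain ⟨⟨rfl, rfl, rfl, rfl⟩, hI⟩ := this
    exact ⟨rfl, hI⟩
  rcases hM with ⟨hI, k, hM⟩ | ⟨k, hM⟩ | ⟨k, hM⟩ | ⟨k, hM⟩
  · have hs : s = s' := threshold_eq s1 s2 b4 b4' fun l hl hl' => (k l (by omega)).2
    have hq : q = q' := threshold_eq' b1 b1' b2 b2'
      (fun l hl hl' hlj => (k l (by omega)).1) hM.2.1
    exact ⟨by clear k; omega, fun _ => hI⟩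
  · have hs : s = j + 1 :=
      threshold_eq s1 (by omega) b4 (by omega) fun l hl hl' => (k l (by omega)).2.2
    have hs' : j + 1 = s' :=
      threshold_eq (by omega) s2 (by omega) b4' fun l hl hl' => (k l (by omega)).2.1
    have hq := threshold_eq' (j := j) b1 b1' b2 b2' (fun l hl hl' hlj => (k l (by omega)).1)
    clear k
    -- As s = s' = j + 1, normality allows x < y only if the threshold of x is at most j, so the two
    -- crossed equivalences with `e` and `e'` close up.
    have hqq : q ≤ j ↔ q' ≤ j := by omega
    have := hq hqq
    clear hq hqq
    exact ⟨by omega, by omega⟩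
  · have hs : s = s' := threshold_eq s1 s2 b4 b4' fun l hl hl' => (k l (by omega)).1
    have hq : q = p + 1 := threshold_eq' (j := j) b1 (by omega) b2 (by omega)
      (fun l hl hl' hlj => (k l (by omega)).2.2) (by omega)
    have hq' : p + 1 = q' := threshold_eq' (j := j) (by omega) b1' (by omega) b2'
      (fun l hl hl' hlj => (k l (by omega)).2.1) (by omega)
    clear k
    exact ⟨by omega, by omega⟩
  · have hs : s = j + 1 :=
      threshold_eq s1 (by omega) b4 (by omega) fun l hl hl' => (k l (by omega)).2.1
    have hs' : j + 1 = s' :=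
      threshold_eq (by omega) s2 (by omega) b4' fun l hl hl' => (k l (by omega)).1
    have hq := threshold_eq' (j := j) (a := q) (b := q') b1 b1' b2 b2' (fun l hl hl' hlj =>
      (k l (by omega)).2.2.2.trans (k l (by omega)).2.2.1)
    clear k
    have hqq : q ≤ j ↔ q' ≤ j := by omega
    have := hq hqq
    clear hq hqq
    exact ⟨by omega, by omega⟩

theorem IsIso.eq_of_height_lt {g : ℕ → ℕ} (h : Normal m C) (h' : Normal m C')
    (hg : IsIso m C C' g) {j : ℕ} (hj : ChainCode.height m C (m + 1) = j) (hp : C.p < j) :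
    C = C' ∧ (Rigid C → ∀ u < m + 2, g u = u) := by
  have hj' : ChainCode.height m C' (m + 1) = j := by rw [← hg.height_eq, hj]
  have hjm : j < m := hj ▸ height_lt h _
  have e1 : (C.p < C.r ∧ C.r = j) ∨ (C.e = 1 ∧ C.p = C.r ∧ C.p + 1 = j) := by
    have := h.p_le_r
    rw [height_succ] at hj
    split_ifs at hj <;> omega
  have e2 : (C'.p < C'.r ∧ C'.r = j) ∨ (C'.e = 1 ∧ C'.p = C'.r ∧ C'.p + 1 = j) := by
    have := h'.p_le_r
    have := hg.p_eq
    rw [height_succ] at hj'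
    split_ifs at hj' <;> omega
  obtain ⟨h1, h2⟩ := (hg.matches h h' hj hp).eq h h' hg.p_eq hp hjm e1 e2
  refine ⟨h1, fun hR u hu => ?_⟩
  obtain ⟨g1, g2, g3, g4⟩ := h2 hR
  have hu' : u = C.p ∨ u = m ∨ u = j ∨ u = m + 1 ∨ (u < m ∧ u ≠ C.p ∧ u ≠ j) := by omega
  rcases hu' with rfl | rfl | rfl | rfl | ⟨hu1, hu2, hu3⟩
  · exact g1
  · exact g2
  · exact g3
  · exact g4
  · exact hg.apply_chain hu1 hu2 (by omega)

/-- For C' ≠ C this gives uniqueness of normal codes; for C' = C it shows that rigid codes have no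
nontrivial automorphism. -/
theorem eq_of_equiv (h : Normal m C) (h' : Normal m C') (f : Fin (m + 2) ≃ Fin (m + 2))
    (hf : ∀ u v : Fin (m + 2), Rel m C u v ↔ Rel m C' (f u) (f v)) :
    C = C' ∧ (Rigid C → ∀ u, f u = u) := by
  have hg := IsIso.of_equiv h h' f hf
  have key : C = C' ∧ (Rigid C →
      ∀ u < m + 2, (fun u => if hu : u < m + 2 then (f ⟨u, hu⟩ : ℕ) else u) u = u) := by
    have hle : C.p ≤ height m C (m + 1) := by
      have := h.p_le_r
      rw [height_succ]
      split_ifs <;> omega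
    rcases hle.eq_or_lt with h1 | h1
    · exact hg.eq_of_height_eq h h' h1
    · exact hg.eq_of_height_lt h h' rfl h1
  refine ⟨key.1, fun hR u => Fin.ext ?_⟩
  simpa using key.2 hR u u.2

end ChainCode
end LocalSym

/-! ### Local symmetry and automorphisms -/

namespace LocalSym

open ChainCode

section

variable {P : Type} [PartialOrder P]

/-- An isomorphism with the retract would turn the quotient map into a surjective, hence injective,
self-map of a finite set; but the quotient identifies a moved element with its image. -/
theorem IsGeneratorCycle.isLocallySymmetric [Finite P] {Q : Type} [PartialOrder Q] [Finite Q] {r : ℕ}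
    {σ : P ≃o P} {S : ZMod r → Set P} (h : IsGeneratorCycle Q r σ S) : IsLocallySymmetric P := by
  refine ⟨Q, inferInstance, inferInstance, r, h.two_le, ?_⟩
  rintro ⟨e⟩
  obtain ⟨a, ha, -⟩ := Set.exists_of_ssubset (h.cycle.ssubset 0)
  have hinj : Function.Injective (Quotient.mk (symmSetoid P Q r)) := by
    have h1 : Function.Surjective (e.symm ∘ (Quotient.mk (symmSetoid P Q r) : P → Retract P Q r)) :=
      e.symm.surjective.comp Quotient.mk_surjective
    exact ((Finite.injective_iff_surjective).2 h1).of_comp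
  have h2 : Quotient.mk (symmSetoid P Q r) a = Quotient.mk (symmSetoid P Q r) (σ a) :=
    Quotient.sound (h.symmetric_apply a)
  exact ha (hinj h2).symm

theorem layers_le_encard (A : Set P) : layers A ≤ A.encard := Set.chainHeight_le_encard _ _

/-- The sets A and B alternate in a cycle with r = 2. Minimality follows from `hmin`: every member
of a cycle contains chains as long as those of Σ(σ), so it has at least that many elements. -/
theorem isLocallySymmetric_of_image [Finite P] (σ : P ≃o P) (A B : Set P) (hA : σ '' A = B)
    (hB : σ '' B = A) (hU : A ∪ B = moved σ) (hA' : A ≠ moved σ) (hB' : B ≠ moved σ)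
    (maxA : MaximallyOrderedIn A (moved σ)) (maxB : MaximallyOrderedIn B (moved σ))
    (layA : layers A = layers (moved σ)) (layB : layers B = layers (moved σ))
    (hmin : A.encard ≤ layers (moved σ)) : IsLocallySymmetric P := by
  have h2 : ∀ i : ZMod 2, i = 0 ∨ i = 1 := by decide
  have h10 : (1 : ZMod 2) ≠ 0 := by decide
  let S : ZMod 2 → Set P := fun i => if i = 0 then A else B
  have S0 : S 0 = A := if_pos rfl
  have S1 : S 1 = B := if_neg h10
  have hcard : B.encard = A.encard := by rw [← hA, σ.injective.encard_image]
  have hgen : IsGeneratorCycle A 2 σ S := by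
    refine ⟨le_rfl, ⟨fun i => ?_, fun i => ?_, fun i => ?_, fun i => ?_, ?_⟩, fun i => ?_,
      fun T hT i => ?_⟩
    · rcases h2 i with rfl | rfl
      · rw [S0]
        exact maxA.1.ssubset_of_ne hA'
      · rw [S1]
        exact maxB.1.ssubset_of_ne hB'
    · rcases h2 i with rfl | rfl
      · rwa [S0]
      · rwa [S1]
    · rcases h2 i with rfl | rfl
      · rw [zero_add, S0, S1, hA]
      · rw [show (1 : ZMod 2) + 1 = 0 by decide, S0, S1, hB]
    · rcases h2 i with rfl | rfl
      · rwa [S0]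
      · rwa [S1]
    · rw [← hU, ← S0, ← S1]
      ext x
      simp only [Set.mem_iUnion, Set.mem_union]
      constructor
      · rintro ⟨i, hi⟩
        rcases h2 i with rfl | rfl
        · exact Or.inl hi
        · exact Or.inr hi
      · rintro (hx | hx)
        · exact ⟨_, hx⟩
        · exact ⟨_, hx⟩
    · rcases h2 i with rfl | rfl
      · rw [S0]
        exact ⟨OrderIso.refl _⟩
      · rw [S1]
        subst hA
        exact ⟨(⟨σ.toEquiv.image A, σ.le_iff_le⟩ : A ≃o σ '' A).symm⟩
    · calc (S i).encard = A.encard := by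
            rcases h2 i with rfl | rfl
            · rw [S0]
            · rw [S1, hcard]
        _ ≤ layers (moved σ) := hmin
        _ = layers (T i) := (hT.layers_eq i).symm
        _ ≤ (T i).encard := layers_le_encard _
  exact hgen.isLocallySymmetric

theorem layers_of_incomparable {A : Set P} (h : ∀ x ∈ A, ∀ y ∈ A, x ≤ y → x = y)
    (hne : A.Nonempty) : layers A = 1 := by
  refine le_antisymm (iSup_le ?_) ((Set.one_le_chainHeight_iff _ _).2 hne)
  rintro ⟨t, ht, hc⟩
  rw [Set.encard_le_one_iff_subsingleton]
  intro x hx y hy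
  rcases hc.total hx hy with h1 | h1
  · exact h x (ht hx) y (ht hy) h1
  · exact (h y (ht hy) x (ht hx) h1).symm

/-- An automorphism of a finite poset moves no element to a comparable one, so Σ(σ) = {a, b} is an
antichain and its two singletons form a cycle. -/
theorem isLocallySymmetric_of_transposition [Finite P] (σ : P ≃o P) {a b : P} (hab : a ≠ b) (ha : σ a = b)
    (hb : σ b = a) (hσ : ∀ x, x ≠ a → x ≠ b → σ x = x) : IsLocallySymmetric P := by
  have hm : moved σ = {a, b} := by
    ext x
    simp only [moved, Set.mem_ofPred_eq, Set.mem_insert_iff, Set.mem_singleton_iff]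
    refine ⟨fun hx => ?_, ?_⟩
    · by_contra! hc
      exact hx (hσ x hc.1 hc.2)
    · rintro (rfl | rfl)
      · rw [ha]
        exact hab.symm
      · rw [hb]
        exact hab
  have hinc : ∀ x ∈ moved σ, ∀ y ∈ moved σ, x ≤ y → x = y := by
    have h1 : ¬ a ≤ b := fun h => hab (by rw [← ha] at h ⊢; exact (apply_eq_of_le_apply σ h).symm)
    have h2 : ¬ b ≤ a := fun h => hab (by rw [← hb] at h; exact ((apply_eq_of_le_apply σ h).symm.trans hb).symm)
    rw [hm]
    rintro x (rfl | rfl) y (rfl | rfl) hxy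
    · rfl
    · exact absurd hxy h1
    · exact absurd hxy h2
    · rfl
  have hmax : ∀ A ⊆ moved σ, MaximallyOrderedIn A (moved σ) := by
    refine fun A hA => ⟨hA, fun A' hA' _ => ?_⟩
    have : orderedPairs A' = ∅ := by
      rw [Set.eq_empty_iff_forall_notMem]
      rintro ⟨x, y⟩ ⟨hx, hy, hxy⟩
      exact hxy.ne (hinc x (hA' hx) y (hA' hy) hxy.le)
    rw [this, Set.encard_empty]
    exact zero_le
  have hlay : ∀ A ⊆ moved σ, A.Nonempty → layers A = 1 := fun A hA =>
    layers_of_incomparable fun x hx y hy => hinc x (hA hx) y (hA hy)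
  have hmem : a ∈ moved σ ∧ b ∈ moved σ := by simp [hm]
  have hsa : {a} ⊆ moved σ := Set.singleton_subset_iff.2 hmem.1
  have hsb : {b} ⊆ moved σ := Set.singleton_subset_iff.2 hmem.2
  have hl := hlay _ subset_rfl ⟨a, hmem.1⟩
  refine isLocallySymmetric_of_image σ {a} {b} (by simp [ha]) (by simp [hb]) ?_ ?_ ?_
    (hmax _ hsa) (hmax _ hsb) ?_ ?_ ?_
  · rw [hm]
    rfl
  · intro h
    exact hab (h ▸ hmem.2 : b ∈ ({a} : Set P)).symm
  · intro h
    exact hab (h ▸ hmem.1 : a ∈ ({b} : Set P))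
  · rw [hl, hlay _ hsa (Set.singleton_nonempty _)]
  · rw [hl, hlay _ hsb (Set.singleton_nonempty _)]
  · rw [hl, Set.encard_singleton]

theorem layers_pair {a b : P} (h : a < b) : layers {a, b} = 2 := by
  rw [← Set.encard_pair h.ne]
  refine (Set.encard_eq_chainHeight_of_isChain _ ?_).symm
  rintro x (rfl | rfl) y (rfl | rfl) hxy
  · exact absurd rfl hxy
  · exact Or.inl h.le
  · exact Or.inr h.le
  · exact absurd rfl hxy

theorem maximallyOrderedIn_pair {a b : P} {M : Set P} (h : a < b) (ha : a ∈ M) (hb : b ∈ M) :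
    MaximallyOrderedIn {a, b} M := by
  refine ⟨Set.insert_subset ha (Set.singleton_subset_iff.2 hb), fun A' _ hc => ?_⟩
  rw [Set.encard_pair h.ne] at hc
  obtain ⟨u, v, -, rfl⟩ := Set.encard_eq_two.1 hc
  have h1 : (1 : ℕ∞) ≤ (orderedPairs {a, b}).encard :=
    Set.one_le_encard_iff_nonempty.2 ⟨(a, b), Or.inl rfl, Or.inr rfl, h⟩
  refine le_trans (Set.encard_le_one_iff_subsingleton.2 ?_) h1
  rintro ⟨x, y⟩ ⟨hx, hy, hxy⟩ ⟨x', y'⟩ ⟨hx', hy', hxy'⟩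
  simp only at *
  rcases hx with rfl | rfl <;> rcases hy with rfl | rfl <;> rcases hx' with rfl | rfl <;>
    rcases hy' with rfl | rfl <;>
    first
    | rfl
    | exact absurd hxy (lt_irrefl _)
    | exact absurd hxy' (lt_irrefl _)
    | exact absurd hxy hxy'.not_gt

/-- The cycle consists of {a, b} and {a', b'}. A chain contains at most one of a, a' and at most one
of b, b', so Σ(σ) has two layers; a two-element chain is maximally ordered because two elements form
at most one ordered pair. -/
theorem isLocallySymmetric_of_double_transposition [Finite P] (σ : P ≃o P) {a b a' b' : P} (hab : a < b)
    (haa : a ≠ a') (hbb : b ≠ b') (hab' : ¬ a < b') (h1 : σ a = a') (h2 : σ a' = a)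
    (h3 : σ b = b') (h4 : σ b' = b)
    (hσ : ∀ x, x ≠ a → x ≠ a' → x ≠ b → x ≠ b' → σ x = x) : IsLocallySymmetric P := by
  have hm : moved σ = {a, a', b, b'} := by
    ext x
    simp only [moved, Set.mem_ofPred_eq, Set.mem_insert_iff, Set.mem_singleton_iff]
    refine ⟨fun hx => ?_, ?_⟩
    · by_contra! hc
      exact hx (hσ x hc.1 hc.2.1 hc.2.2.1 hc.2.2.2)
    · rintro (rfl | rfl | rfl | rfl)
      · rw [h1]
        exact haa.symm
      · rw [h2]
        exact haa
      · rw [h3]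
        exact hbb.symm
      · rw [h4]
        exact hbb
  have hlt : a' < b' := by
    rw [← h1, ← h3]
    exact σ.strictMono hab
  have i1 : ¬ a ≤ a' := fun h => haa (by rw [← h1] at h ⊢; exact (apply_eq_of_le_apply σ h).symm)
  have i2 : ¬ a' ≤ a := fun h => i1 (by have := σ.monotone h; rwa [h1, h2] at this)
  have i3 : ¬ b ≤ b' := fun h => hbb (by rw [← h3] at h ⊢; exact (apply_eq_of_le_apply σ h).symm)
  have i4 : ¬ b' ≤ b := fun h => i3 (by have := σ.monotone h; rwa [h3, h4] at this)
  have ma : a ∈ moved σ := by simp [hm]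
  have ma' : a' ∈ moved σ := by simp [hm]
  have mb : b ∈ moved σ := by simp [hm]
  have mb' : b' ∈ moved σ := by simp [hm]
  have hl : layers (moved σ) = 2 := by
    refine le_antisymm (iSup_le ?_) ?_
    · rintro ⟨t, ht, hc⟩
      have k1 : ¬ (a ∈ t ∧ a' ∈ t) := fun h => (hc.total h.1 h.2).elim i1 i2
      have k2 : ¬ (b ∈ t ∧ b' ∈ t) := fun h => (hc.total h.1 h.2).elim i3 i4
      classical
      obtain ⟨x, y, hxy⟩ : ∃ x y, t ⊆ {x, y} := by
        rw [hm] at ht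
        refine ⟨if a ∈ t then a else a', if b ∈ t then b else b', fun z hz => ?_⟩
        rcases ht hz with rfl | rfl | rfl | rfl
        · exact Or.inl (if_pos hz).symm
        · exact Or.inl (if_neg fun h => k1 ⟨h, hz⟩).symm
        · exact Or.inr (if_pos hz).symm
        · exact Or.inr (if_neg fun h => k2 ⟨h, hz⟩).symm
      exact (Set.encard_le_encard hxy).trans ((Set.encard_insert_le _ _).trans
        (by rw [Set.encard_singleton]; rfl))
    · rw [← layers_pair hab]
      exact Set.chainHeight_mono _ _ _ (Set.insert_subset ma (Set.singleton_subset_iff.2 mb))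
  refine isLocallySymmetric_of_image σ {a, b} {a', b'} ?_ ?_ ?_ ?_ ?_
    (maximallyOrderedIn_pair hab ma mb) (maximallyOrderedIn_pair hlt ma' mb') ?_ ?_ ?_
  · rw [Set.image_pair, h1, h3]
  · rw [Set.image_pair, h2, h4]
  · rw [hm]
    ext x
    simp only [Set.mem_union, Set.mem_insert_iff, Set.mem_singleton_iff]
    tauto
  · intro h
    rcases (h ▸ ma' : a' ∈ ({a, b} : Set P)) with h | h
    · exact haa h.symm
    · rw [Set.mem_singleton_iff] at h
      exact i1 (h ▸ hab.le)
  · intro h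
    rcases (h ▸ ma : a ∈ ({a', b'} : Set P)) with h | h
    · exact haa h
    · rw [Set.mem_singleton_iff] at h
      exact i2 (h ▸ hlt.le)
  · rw [hl, layers_pair hab]
  · rw [hl, layers_pair hlt]
  · rw [hl, Set.encard_pair hab.ne]

/-- Symmetric elements are related by an automorphism, so all classes are singletons. -/
theorem isLocallyUnsymmetric_of_forall_eq [Finite P] (h : ∀ (σ : P ≃o P) (x : P), σ x = x) :
    IsLocallyUnsymmetric P := by
  rintro ⟨Q, _, _, r, -, hr⟩
  refine hr ?_
  have hstep : ∀ a b : P, SymmetricElements Q r a b → a = b := by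
    intro a b hab
    obtain ⟨g, hg, -⟩ := hab.exists_automorphism
    rw [← hg, h]
  let f : P → Retract P Q r := Quotient.mk (symmSetoid P Q r)
  have hf : Function.Bijective f :=
    ⟨fun a b hab => hstep _ _ (Quotient.exact hab), Quotient.mk_surjective⟩
  refine ⟨⟨Equiv.ofBijective f hf, ?_⟩⟩
  intro a b
  constructor
  · rintro ⟨a', b', ha, hb, hab⟩
    rwa [hf.1 ha, hf.1 hb] at hab
  · exact fun hab => ⟨a, b, rfl, rfl, hab⟩

end

/-! ### Automorphisms of coded posets -/

namespace ChainCode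

variable {m : ℕ} {C : ChainCode} {P : Type} [PartialOrder P]

/-- A permutation preserving the relation of a code, as an automorphism. -/
def automorphism (g : Fin (m + 2) ≃ P) (hg : ∀ u v, g u < g v ↔ Rel m C u v)
    (π : Fin (m + 2) ≃ Fin (m + 2)) (hπ : ∀ u v, Rel m C (π u) (π v) ↔ Rel m C u v) : P ≃o P where
  toEquiv := (g.symm.trans π).trans g
  map_rel_iff' := by
    intro a b
    obtain ⟨u, rfl⟩ := g.surjective a
    obtain ⟨v, rfl⟩ := g.surjective b
    simp [le_iff_lt_or_eq, hg, hπ]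

theorem automorphism_apply (g : Fin (m + 2) ≃ P) (hg : ∀ u v, g u < g v ↔ Rel m C u v)
    (π : Fin (m + 2) ≃ Fin (m + 2)) (hπ : ∀ u v, Rel m C (π u) (π v) ↔ Rel m C u v)
    (u : Fin (m + 2)) : automorphism g hg π hπ (g u) = g (π u) := by
  change g (π (g.symm (g u))) = _
  rw [Equiv.symm_apply_apply]

theorem isLocallySymmetric_of_swap [Finite P] (g : Fin (m + 2) ≃ P)
    (hg : ∀ u v, g u < g v ↔ Rel m C u v) (a b : Fin (m + 2)) (hab : a ≠ b)
    (hπ : ∀ u v, Rel m C (Equiv.swap a b u) (Equiv.swap a b v) ↔ Rel m C u v) :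
    IsLocallySymmetric P := by
  refine isLocallySymmetric_of_transposition (automorphism g hg _ hπ) (a := g a) (b := g b)
    (g.injective.ne hab) ?_ ?_ ?_
  · rw [automorphism_apply, Equiv.swap_apply_left]
  · rw [automorphism_apply, Equiv.swap_apply_right]
  · intro x ha hb
    obtain ⟨u, rfl⟩ := g.surjective x
    rw [automorphism_apply, Equiv.swap_apply_of_ne_of_ne]
    · rintro rfl
      exact ha rfl
    · rintro rfl
      exact hb rfl

/-- This and the next two lemmas treat the possible twins, incomparable elements with the same
elements above and below: x and y, x and c_p, y and c_r. -/
theorem rel_swap_fst_snd (hr : C.p = C.r) (hs : C.q = C.s) (he : C.e = 0) (hp : C.p ≤ m)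
    (u v : Fin (m + 2)) :
    Rel m C (Equiv.swap ⟨m, by omega⟩ ⟨m + 1, by omega⟩ u : Fin (m + 2))
      (Equiv.swap ⟨m, by omega⟩ ⟨m + 1, by omega⟩ v : Fin (m + 2)) ↔ Rel m C u v := by
  have := u.2
  have := v.2
  simp only [coe_swap, ChainCode.Rel]
  split_ifs <;> constructor <;> rintro (h | h | h | h | h | h) <;> omega

theorem rel_swap_fst (hp : C.p < m) (hq : C.q = C.p + 1) (hr : C.r ≤ m)
    (he : C.e = 1 ∧ C.p < C.r ∨ C.e = 0 ∧ C.r ≤ C.p) (hs : C.p < C.s)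
    (u v : Fin (m + 2)) :
    Rel m C (Equiv.swap ⟨m, by omega⟩ ⟨C.p, by omega⟩ u : Fin (m + 2))
      (Equiv.swap ⟨m, by omega⟩ ⟨C.p, by omega⟩ v : Fin (m + 2)) ↔ Rel m C u v := by
  have := u.2
  have := v.2
  simp only [coe_swap, ChainCode.Rel]
  split_ifs <;> constructor <;> rintro (h | h | h | h | h | h) <;> omega

theorem rel_swap_snd (hr : C.r < m) (hs : C.s = C.r + 1) (hp : C.p ≤ C.r)
    (he : C.e = 1 ∧ C.q ≤ C.r ∨ C.e = 0 ∧ C.r < C.q) (u v : Fin (m + 2)) :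
    Rel m C (Equiv.swap ⟨m + 1, by omega⟩ ⟨C.r, by omega⟩ u : Fin (m + 2))
      (Equiv.swap ⟨m + 1, by omega⟩ ⟨C.r, by omega⟩ v : Fin (m + 2)) ↔ Rel m C u v := by
  have := u.2
  have := v.2
  simp only [coe_swap, ChainCode.Rel]
  split_ifs <;> constructor <;> rintro (h | h | h | h | h | h) <;> omega

theorem isLocallySymmetric_of_not_rigid [Finite P] (h : Normal m C) (hC : ¬ Rigid C)
    (g : Fin (m + 2) ≃ P) (hg : ∀ u v, g u < g v ↔ Rel m C u v) : IsLocallySymmetric P := by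
  have b1 := h.p_lt_q
  have b2 := h.q_le
  have b3 := h.r_lt_s
  have b4 := h.s_le
  have key : (C.e = 0 ∧ C.p = C.r ∧ C.q = C.s) ∨
      (C.q = C.p + 1 ∧ C.p < C.s ∧ (C.e = 1 ∧ C.p < C.r ∨ C.e = 0 ∧ C.r ≤ C.p)) ∨
      (C.s = C.r + 1 ∧ C.p < C.r ∧ (C.e = 1 ∧ C.q ≤ C.r ∨ C.e = 0 ∧ C.r < C.q)) ∨
      (C.e = 1 ∧ C.p = C.r ∧ C.q = C.p + 2 ∧ C.s = C.p + 2) := by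
    unfold Rigid at hC
    rcases h.cases with b6 | b6 | b6 | b6
    · by_cases hq : C.q = C.s
      · exact Or.inl ⟨b6.1, b6.2.1, hq⟩
      · refine Or.inr (Or.inl ?_)
        omega
    · refine Or.inr (Or.inr (Or.inl ?_))
      omega
    · refine Or.inr (Or.inr (Or.inr ?_))
      omega
    · by_cases hq : C.q = C.p + 1
      · refine Or.inr (Or.inl ?_)
        omega
      · refine Or.inr (Or.inr (Or.inl ?_))
        omega
  rcases key with ⟨k1, k2, k3⟩ | ⟨k1, k2, k3⟩ | ⟨k1, k2, k3⟩ | ⟨k1, k2, k3, k4⟩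
  · exact isLocallySymmetric_of_swap g hg _ _ (by simp)
      (rel_swap_fst_snd k2 k3 k1 (by omega))
  · refine isLocallySymmetric_of_swap g hg _ _ ?_ (rel_swap_fst (by omega) k1 (by omega) k3 k2)
    rw [Ne, Fin.mk.injEq]
    omega
  · refine isLocallySymmetric_of_swap g hg _ _ ?_ (rel_swap_snd (by omega) k1 (by omega) k3)
    rw [Ne, Fin.mk.injEq]
    omega
  · clear hC
    obtain ⟨p, q, r, s, e⟩ := C
    simp only at b1 b2 b3 b4 k1 k2 k3 k4
    -- The chains x < y and c_p < c_{p+1} have the same outside elements above and below, and are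
    -- exchanged as a whole.
    let π := (Equiv.swap (⟨m, by omega⟩ : Fin (m + 2)) ⟨p, by omega⟩).trans
      (Equiv.swap ⟨m + 1, by omega⟩ ⟨p + 1, by omega⟩)
    have hπv : ∀ u : Fin (m + 2), (π u : ℕ) = if u.1 = m then p else if u.1 = p then m else
        if u.1 = m + 1 then p + 1 else if u.1 = p + 1 then m + 1 else u := by
      intro u
      simp only [π, Equiv.trans_apply, coe_swap]
      split_ifs <;> omega
    have hπ : ∀ u v, ChainCode.Rel m ⟨p, q, r, s, e⟩ (π u) (π v) ↔
        ChainCode.Rel m ⟨p, q, r, s, e⟩ u v := by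
      intro u v
      have := u.2
      have := v.2
      simp only [hπv, ChainCode.Rel]
      split_ifs <;> constructor <;> rintro (h | h | h | h | h | h) <;> omega
    refine isLocallySymmetric_of_double_transposition (automorphism g hg π hπ)
      (a := g ⟨p, by omega⟩) (b := g ⟨p + 1, by omega⟩) (a' := g ⟨m, by omega⟩)
      (b' := g ⟨m + 1, by omega⟩) ?_ ?_ ?_ ?_ ?_ ?_ ?_ ?_ ?_
    · rw [hg]
      unfold ChainCode.Rel
      simp only
      omega
    · rw [Ne, g.injective.eq_iff, Fin.mk.injEq]
      omega
    · rw [Ne, g.injective.eq_iff, Fin.mk.injEq]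
      omega
    · rw [hg]
      unfold ChainCode.Rel
      simp only
      omega
    · rw [automorphism_apply, g.injective.eq_iff, Fin.ext_iff, hπv]
      simp only
      split_ifs <;> omega
    · rw [automorphism_apply, g.injective.eq_iff, Fin.ext_iff, hπv]
      simp
    · rw [automorphism_apply, g.injective.eq_iff, Fin.ext_iff, hπv]
      simp only
      split_ifs <;> omega
    · rw [automorphism_apply, g.injective.eq_iff, Fin.ext_iff, hπv]
      simp only
      split_ifs <;> omega
    · intro x x1 x2 x3 x4
      obtain ⟨u, rfl⟩ := g.surjective x
      rw [Ne, g.injective.eq_iff, Fin.ext_iff] at x1 x2 x3 x4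
      rw [automorphism_apply, g.injective.eq_iff, Fin.ext_iff, hπv, if_neg x2, if_neg x1,
        if_neg x4, if_neg x3]

theorem isLocallyUnsymmetric_of_rigid [Finite P] (h : Normal m C) (hC : Rigid C)
    (g : Fin (m + 2) ≃ P) (hg : ∀ u v, g u < g v ↔ Rel m C u v) : IsLocallyUnsymmetric P := by
  refine isLocallyUnsymmetric_of_forall_eq fun σ x => ?_
  have h1 := (eq_of_equiv h h ((g.trans σ.toEquiv).trans g.symm) (fun u v => by
    rw [← hg, ← hg]
    simp)).2 hC (g.symm x)
  simpa [Equiv.symm_apply_eq] using h1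

end ChainCode
end LocalSym

/-! ### Counting normal codes -/

namespace LocalSym
namespace ChainCode

open Finset

/-- The codes with given `e`, with `r < M`, and with `p`, `s`, `q` chosen successively. -/
def family (e M : ℕ) (A : ℕ → Finset ℕ) (B : ℕ → ℕ → Finset ℕ) (D : ℕ → ℕ → ℕ → Finset ℕ) :
    Finset ChainCode :=
  ((range M).sigma fun r => (A r).sigma fun p => (B r p).sigma fun s => D r p s).map
    ⟨fun x => ⟨x.2.1, x.2.2.2, x.1, x.2.2.1, e⟩, by
      rintro ⟨r, p, s, q⟩ ⟨r', p', s', q'⟩ h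
      simp only [ChainCode.mk.injEq] at h
      obtain ⟨rfl, rfl, rfl, rfl, -⟩ := h
      rfl⟩

theorem mem_family {e M : ℕ} {A : ℕ → Finset ℕ} {B : ℕ → ℕ → Finset ℕ}
    {D : ℕ → ℕ → ℕ → Finset ℕ} {C : ChainCode} :
    C ∈ family e M A B D ↔
      C.e = e ∧ C.r < M ∧ C.p ∈ A C.r ∧ C.s ∈ B C.r C.p ∧ C.q ∈ D C.r C.p C.s := by
  unfold family
  simp only [mem_map, mem_sigma, mem_range]
  constructor
  · rintro ⟨x, h, rfl⟩
    exact ⟨rfl, h⟩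
  · rintro ⟨rfl, h⟩
    exact ⟨⟨C.r, C.p, C.s, C.q⟩, h, rfl⟩

theorem card_family {e M : ℕ} {A : ℕ → Finset ℕ} {B : ℕ → ℕ → Finset ℕ}
    {D : ℕ → ℕ → ℕ → Finset ℕ} {F : ℕ → ℚ}
    (hF : ∀ r < M, ∑ p ∈ A r, ∑ s ∈ B r p, ((D r p s).card : ℚ) = F r) :
    ((family e M A B D).card : ℚ) = ∑ r ∈ range M, F r := by
  simp only [family, card_map, card_sigma, Nat.cast_sum]
  exact sum_congr rfl fun r hr => hF r (mem_range.1 hr)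

/-- The hypothesis allows the empty interval a = m + 1, where the closed form vanishes; below this
covers the largest values of r. -/
theorem sum_Icc_add (a m : ℕ) (c : ℚ) (h : a ≤ m + 1) :
    ∑ s ∈ Icc a m, ((s : ℚ) + c) = (m + 1 - a) * ((m + a) / 2 + c) := by
  induction m with
  | zero =>
    interval_cases a <;> simp
  | succ m ih =>
    rcases h.eq_or_lt with rfl | h
    · rw [Icc_eq_empty (by omega)]
      push_cast
      simp
    · rw [sum_Icc_succ_top (by omega), ih (by omega)]
      push_cast
      ring

theorem sum_range_sub (k : ℕ) (c : ℚ) :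
    ∑ p ∈ range k, (c - (p : ℚ)) = k * c - k * (k - 1) / 2 := by
  induction k with
  | zero => simp
  | succ k ih =>
    rw [sum_range_succ, ih]
    push_cast
    ring

theorem sum_range_cubic (k : ℕ) (a b c d : ℚ) :
    ∑ r ∈ range k, (a + b * r + c * (r : ℚ) ^ 2 + d * (r : ℚ) ^ 3) =
      a * k + b * (k * (k - 1) / 2) + c * (k * (k - 1) * (2 * k - 1) / 6) +
        d * (k * (k - 1) / 2) ^ 2 := by
  induction k with
  | zero => simp
  | succ k ih =>
    rw [sum_range_succ, ih]
    push_cast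
    ring

theorem cast_card_Icc {a b : ℕ} (h : a ≤ b + 1) : ((Icc a b).card : ℚ) = b + 1 - a := by
  rw [Nat.card_Icc, Nat.cast_sub h]
  push_cast
  rfl

theorem cast_card_Ioc {a b : ℕ} (h : a ≤ b) : ((Ioc a b).card : ℚ) = b - a := by
  rw [Nat.card_Ioc, Nat.cast_sub h]

variable (m : ℕ)

theorem card_unlinked_eq : ((family 0 m (fun r => {r}) (fun r _ => Icc (r + 1) m)
    fun r _ s => Icc (r + 1) s).card : ℚ) =
      ∑ r ∈ range m, ((m : ℚ) - r) * (m - r + 1) / 2 := by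
  refine card_family fun r hr => ?_
  rw [sum_singleton]
  calc _ = ∑ s ∈ Icc (r + 1) m, ((s : ℚ) + (-r)) := sum_congr rfl fun s hs => by
        rw [cast_card_Icc (by have := mem_Icc.1 hs; omega)]
        push_cast
        ring
    _ = _ := by
        rw [sum_Icc_add _ _ _ (by omega)]
        push_cast
        ring

theorem card_unlinked_lt : ((family 0 m (fun r => range r) (fun r _ => Icc (r + 1) m)
    fun r _ _ => Icc r m).card : ℚ) = ∑ r ∈ range m, (r : ℚ) * (m - r) * (m + 1 - r) := by
  refine card_family fun r hr => ?_
  rw [cast_card_Icc (by omega)]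
  simp only [sum_const, card_range, nsmul_eq_mul]
  rw [cast_card_Icc (by omega)]
  push_cast
  ring

theorem card_linked_eq : ((family 1 m (fun r => {r}) (fun r _ => Icc (r + 2) m)
    fun r _ s => Icc (r + 2) s).card : ℚ) =
      ∑ r ∈ range m, ((m : ℚ) - 1 - r) * (m - r) / 2 := by
  refine card_family fun r hr => ?_
  rw [sum_singleton]
  calc _ = ∑ s ∈ Icc (r + 2) m, ((s : ℚ) + (-r - 1)) := sum_congr rfl fun s hs => by
        rw [cast_card_Icc (by have := mem_Icc.1 hs; omega)]
        push_cast
        ring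
    _ = _ := by
        rw [sum_Icc_add _ _ _ (by omega)]
        push_cast
        ring

theorem card_linked_le : ((family 1 m (fun r => range r) (fun r _ => Ioc r m)
    fun r p _ => Ioc p r).card : ℚ) = ∑ r ∈ range m, (r : ℚ) * (r + 1) / 2 * (m - r) := by
  refine card_family fun r hr => ?_
  simp only [sum_const, nsmul_eq_mul]
  rw [← mul_sum, cast_card_Ioc hr.le]
  calc _ = ((m : ℚ) - r) * ∑ p ∈ range r, ((r : ℚ) - p) := by
        congr 1
        exact sum_congr rfl fun p hp => cast_card_Ioc (mem_range.1 hp).le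
    _ = _ := by
        rw [sum_range_sub]
        ring

theorem card_linked_lt : ((family 1 m (fun r => range r) (fun r _ => Icc (r + 2) m)
    fun r _ s => Ioc r s).card : ℚ) =
      ∑ r ∈ range m, (r : ℚ) * ((m - 1 - r) * (m + 2 - r) / 2) := by
  refine card_family fun r hr => ?_
  rw [sum_const, card_range, nsmul_eq_mul]
  congr 1
  calc _ = ∑ s ∈ Icc (r + 2) m, ((s : ℚ) + (-r)) := sum_congr rfl fun s hs => by
        rw [cast_card_Ioc (by have := mem_Icc.1 hs; omega)]
        ring
    _ = _ := by
        rw [sum_Icc_add _ _ _ (by omega)]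
        push_cast
        ring

theorem card_rigid_unlinked_eq : ((family 0 m (fun r => {r}) (fun r _ => Icc (r + 2) m)
    fun r _ s => Ico (r + 2) s).card : ℚ) =
      ∑ r ∈ range m, ((m : ℚ) - 1 - r) * (m - 2 - r) / 2 := by
  refine card_family fun r hr => ?_
  rw [sum_singleton]
  calc _ = ∑ s ∈ Icc (r + 2) m, ((s : ℚ) + (-r - 2)) := sum_congr rfl fun s hs => by
        rw [Nat.card_Ico, Nat.cast_sub (by have := mem_Icc.1 hs; omega)]
        push_cast
        ring
    _ = _ := by
        rw [sum_Icc_add _ _ _ (by omega)]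
        push_cast
        ring

theorem card_rigid_unlinked_eq_r : ((family 0 m (fun r => range r) (fun r _ => Ioc r m)
    fun r _ _ => {r}).card : ℚ) = ∑ r ∈ range m, (r : ℚ) * (m - r) := by
  refine card_family fun r hr => ?_
  simp only [sum_const, card_range, card_singleton, nsmul_eq_mul]
  rw [cast_card_Ioc hr.le]
  simp

theorem card_rigid_unlinked_gt : ((family 0 m (fun r => range r) (fun r _ => Icc (r + 2) m)
    fun r _ _ => Ioc r m).card : ℚ) = ∑ r ∈ range m, (r : ℚ) * (m - r) * (m - 1 - r) := by
  refine card_family fun r hr => ?_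
  rw [cast_card_Ioc hr.le]
  simp only [sum_const, card_range, nsmul_eq_mul]
  rw [cast_card_Icc (by omega)]
  push_cast
  ring

/-- The range stops at m - 1 because at r = m - 1 the polynomial takes the value -1 although no code
exists. -/
theorem card_rigid_linked_eq : ((family 1 (m - 1) (fun r => {r}) (fun r _ => Icc (r + 3) m)
    fun r _ s => Icc (r + 2) s).card : ℚ) =
      ∑ r ∈ range (m - 1), ((m : ℚ) - 2 - r) * (m + 1 - r) / 2 := by
  refine card_family fun r hr => ?_
  rw [sum_singleton]
  calc _ = ∑ s ∈ Icc (r + 3) m, ((s : ℚ) + (-r - 1)) := sum_congr rfl fun s hs => by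
        rw [cast_card_Icc (by have := mem_Icc.1 hs; omega)]
        push_cast
        ring
    _ = _ := by
        rw [sum_Icc_add _ _ _ (by omega)]
        push_cast
        ring

theorem card_rigid_linked_le : ((family 1 m (fun r => range r) (fun r _ => Icc (r + 2) m)
    fun r p _ => Ioc (p + 1) r).card : ℚ) =
      ∑ r ∈ range m, (r : ℚ) * (r - 1) / 2 * (m - 1 - r) := by
  refine card_family fun r hr => ?_
  simp only [sum_const, nsmul_eq_mul]
  rw [← mul_sum, cast_card_Icc (by omega)]
  calc _ = ((m : ℚ) + 1 - ((r + 2 : ℕ) : ℚ)) * ∑ p ∈ range r, ((r : ℚ) - 1 - p) := by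
        congr 1
        refine sum_congr rfl fun p hp => ?_
        rw [cast_card_Ioc (mem_range.1 hp)]
        push_cast
        ring
    _ = _ := by
        rw [sum_range_sub]
        push_cast
        ring

/-- The blocks are the four cases of `Normal`, the last one split into q ≤ r and r < q. -/
theorem ncard_normal : (({C | Normal m C}.ncard : ℕ) : ℚ) =
    1 / 6 * m * (((m : ℚ) + 2) ^ 3 - 2 * (m + 2) ^ 2 - 5 * (m + 2) + 12) := by
  classical
  have hset : {C | Normal m C} = ((
      (family 0 m (fun r => {r}) (fun r _ => Icc (r + 1) m) fun r _ s => Icc (r + 1) s) ∪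
      (family 0 m (fun r => range r) (fun r _ => Icc (r + 1) m) fun r _ _ => Icc r m) ∪
      (family 1 m (fun r => {r}) (fun r _ => Icc (r + 2) m) fun r _ s => Icc (r + 2) s) ∪
      (family 1 m (fun r => range r) (fun r _ => Ioc r m) fun r p _ => Ioc p r) ∪
      (family 1 m (fun r => range r) (fun r _ => Icc (r + 2) m) fun r _ s => Ioc r s) :
        Finset ChainCode) : Set ChainCode) := by
    ext C
    simp only [coe_union, Set.mem_union, mem_coe, mem_family, mem_singleton, mem_range, mem_Icc,
      mem_Ioc, Set.mem_ofPred_eq]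
    constructor
    · rintro ⟨h1, h2, h3, h4, h5, h6⟩
      omega
    · intro h
      constructor <;> omega
  rw [hset, Set.ncard_coe_finset, card_union_of_disjoint, card_union_of_disjoint,
    card_union_of_disjoint, card_union_of_disjoint]
  · push_cast
    rw [card_unlinked_eq, card_unlinked_lt, card_linked_eq, card_linked_le, card_linked_lt,
      ← sum_add_distrib, ← sum_add_distrib, ← sum_add_distrib, ← sum_add_distrib]
    -- The arguments are the coefficients of 1, r, r², r³ in the sum of the five summands.
    have key := sum_range_cubic m ((m : ℚ) ^ 2)
      (-(2 * m) + (m ^ 2 + m) + m / 2 + (m - 1) * (m + 2) / 2)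
      (1 - (2 * m + 1) + (m - 1) / 2 - (2 * m + 1) / 2) 1
    calc _ = _ := sum_congr rfl fun r _ => ?_
      _ = _ := key
      _ = _ := ?_
    · ring
    · ring
  all_goals
    rw [disjoint_left]
    intro C h1 h2
    simp only [mem_union, mem_family, mem_singleton, mem_range, mem_Icc, mem_Ioc] at h1 h2
    omega

/-- The blocks are the cases of `Rigid`, with p < r split by q = r or r < q when e = 0, and by q ≤ r
or r < q when e = 1. -/
theorem ncard_normal_rigid (hm : 1 ≤ m) : (({C | Normal m C ∧ Rigid C}.ncard : ℕ) : ℚ) =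
    1 / 6 * ((m : ℚ) - 1) * (((m : ℚ) + 2) ^ 3 - 4 * (m + 2) ^ 2 + 2 * (m + 2) - 2) := by
  classical
  have hset : {C | Normal m C ∧ Rigid C} = ((
      (family 0 m (fun r => {r}) (fun r _ => Icc (r + 2) m) fun r _ s => Ico (r + 2) s) ∪
      (family 0 m (fun r => range r) (fun r _ => Ioc r m) fun r _ _ => {r}) ∪
      (family 0 m (fun r => range r) (fun r _ => Icc (r + 2) m) fun r _ _ => Ioc r m) ∪
      (family 1 (m - 1) (fun r => {r}) (fun r _ => Icc (r + 3) m) fun r _ s => Icc (r + 2) s) ∪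
      (family 1 m (fun r => range r) (fun r _ => Icc (r + 2) m) fun r p _ => Ioc (p + 1) r) ∪
      (family 1 m (fun r => range r) (fun r _ => Icc (r + 2) m) fun r _ s => Ioc r s) :
        Finset ChainCode) : Set ChainCode) := by
    ext C
    simp only [coe_union, Set.mem_union, mem_coe, mem_family, mem_singleton, mem_range, mem_Icc,
      mem_Ioc, mem_Ico, Set.mem_ofPred_eq]
    constructor
    · rintro ⟨⟨h1, h2, h3, h4, h5, h6⟩, hr⟩
      rcases hr with hr | ⟨hr, hr', hq | hs⟩ | hr | ⟨hr, hr', hr''⟩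
      · iterate 5 refine Or.inl ?_
        clear h6
        omega
      · iterate 4 refine Or.inl ?_
        refine Or.inr ?_
        clear h6
        omega
      · by_cases hq : C.q = C.r
        · iterate 4 refine Or.inl ?_
          refine Or.inr ?_
          clear h6
          omega
        · iterate 3 refine Or.inl ?_
          refine Or.inr ?_
          omega
      · iterate 2 refine Or.inl ?_
        refine Or.inr ?_
        omega
      · by_cases hq : C.q ≤ C.r
        · refine Or.inl (Or.inr ?_)
          clear h6
          omega
        · refine Or.inr ?_
          omega
    · rintro (((((h | h) | h) | h) | h) | h)
      · exact ⟨⟨by omega, by omega, by omega, by omega, by omega, Or.inl (by omega)⟩,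
          Or.inl (by omega)⟩
      · exact ⟨⟨by omega, by omega, by omega, by omega, by omega, Or.inr (Or.inl (by omega))⟩,
          Or.inr (Or.inl (by omega))⟩
      · exact ⟨⟨by omega, by omega, by omega, by omega, by omega, Or.inr (Or.inl (by omega))⟩,
          Or.inr (Or.inl (by omega))⟩
      · exact ⟨⟨by omega, by omega, by omega, by omega, by omega,
          Or.inr (Or.inr (Or.inl (by omega)))⟩, Or.inr (Or.inr (Or.inl (by omega)))⟩
      · exact ⟨⟨by omega, by omega, by omega, by omega, by omega,
          Or.inr (Or.inr (Or.inr (by omega)))⟩, Or.inr (Or.inr (Or.inr (by omega)))⟩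
      · exact ⟨⟨by omega, by omega, by omega, by omega, by omega,
          Or.inr (Or.inr (Or.inr (by omega)))⟩, Or.inr (Or.inr (Or.inr (by omega)))⟩
  rw [hset, Set.ncard_coe_finset, card_union_of_disjoint, card_union_of_disjoint,
    card_union_of_disjoint, card_union_of_disjoint, card_union_of_disjoint]
  · push_cast
    rw [card_rigid_unlinked_eq, card_rigid_unlinked_eq_r, card_rigid_unlinked_gt,
      card_rigid_linked_eq, card_rigid_linked_le, card_linked_lt]
    obtain ⟨k, rfl⟩ : ∃ k, m = k + 1 := ⟨m - 1, by omega⟩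
    have h1 := sum_range_succ (fun r : ℕ => (((k + 1 : ℕ) : ℚ) - 2 - r) * ((k + 1 : ℕ) + 1 - r) / 2) k
    -- The fourth sum is extended to r = k, where its summand is -1; this accounts for the final `-
    -- 1`.
    have key : ∑ r ∈ range (k + 1), (((k + 1 : ℕ) : ℚ) - 1 - r) * ((k + 1 : ℕ) - 2 - r) / 2 +
        ∑ r ∈ range (k + 1), (r : ℚ) * ((k + 1 : ℕ) - r) +
        ∑ r ∈ range (k + 1), (r : ℚ) * ((k + 1 : ℕ) - r) * ((k + 1 : ℕ) - 1 - r) +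
        ∑ r ∈ range (k + 1), (((k + 1 : ℕ) : ℚ) - 2 - r) * ((k + 1 : ℕ) + 1 - r) / 2 +
        ∑ r ∈ range (k + 1), (r : ℚ) * (r - 1) / 2 * ((k + 1 : ℕ) - 1 - r) +
        ∑ r ∈ range (k + 1), (r : ℚ) * (((k + 1 : ℕ) - 1 - r) * ((k + 1 : ℕ) + 2 - r) / 2) =
        1 / 6 * (((k + 1 : ℕ) : ℚ) - 1) * ((((k + 1 : ℕ) : ℚ) + 2) ^ 3 -
          4 * ((k + 1 : ℕ) + 2) ^ 2 + 2 * ((k + 1 : ℕ) + 2) - 2) - 1 := by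
      generalize k + 1 = m
      rw [← sum_add_distrib, ← sum_add_distrib, ← sum_add_distrib, ← sum_add_distrib,
        ← sum_add_distrib]
      have key := sum_range_cubic m (((m : ℚ) - 1) * (m - 2) / 2 + (m - 2) * (m + 1) / 2)
        (-(2 * m - 3) / 2 + m + m * (m - 1) - (2 * m - 1) / 2 - (m - 1) / 2 + (m - 1) * (m + 2) / 2)
        (1 / 2 - 1 - (2 * m - 1) + 1 / 2 + m / 2 - (2 * m + 1) / 2) 1
      calc _ = _ := sum_congr rfl fun r _ => ?_
        _ = _ := key
        _ = _ := ?_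
      · ring
      · ring
    rw [h1] at key
    rw [Nat.add_sub_cancel]
    push_cast at key ⊢
    linear_combination key
  all_goals
    rw [disjoint_left]
    intro C h1 h2
    simp only [mem_union, mem_family, mem_singleton, mem_range, mem_Icc, mem_Ioc, mem_Ico] at h1 h2
    omega

end ChainCode
end LocalSym

/-! ### Normal codes and unlabelled posets -/

namespace LocalSym

namespace ChainCode

variable {m : ℕ} {C C' : ChainCode}

/-- Heights are distinct along a chain and smaller than m, which bounds its size; c_0, …, c_{m-1}
attains the bound. -/
theorem layers_univ {P : Type} [PartialOrder P] (h : Normal m C) (g : Fin (m + 2) ≃ P)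
    (hg : ∀ u v, g u < g v ↔ Rel m C u v) : layers (Set.univ : Set P) = m := by
  refine le_antisymm (iSup_le ?_) ?_
  · rintro ⟨t, -, hc⟩
    have hmono : ∀ x y : P, x < y → height m C (g.symm x) < height m C (g.symm y) :=
      fun x y hxy => height_strictMono h ((hg _ _).1 (by simpa using hxy))
    have hinj : Set.InjOn (fun x => height m C (g.symm x)) t := by
      intro x hx y hy hxy
      by_contra hne
      rcases hc.total hx hy with h1 | h1
      · exact (hmono x y (lt_of_le_of_ne h1 hne)).ne hxy
      · exact (hmono y x (lt_of_le_of_ne h1 (Ne.symm hne))).ne' hxy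
    have hsub : (fun x => height m C (g.symm x)) '' t ⊆ (Finset.range m : Set ℕ) := by
      rintro _ ⟨x, -, rfl⟩
      exact Finset.mem_coe.2 (Finset.mem_range.2 (height_lt h (g.symm x)))
    have := Set.encard_le_encard hsub
    rwa [hinj.encard_image, Set.encard_coe_eq_coe_finsetCard, Finset.card_range] at this
  · let f : Fin m → P := fun k => g ⟨k, by omega⟩
    have hf : Function.Injective f := fun a b hab =>
      Fin.ext (Fin.mk.inj_iff.1 (g.injective hab))
    have hc : IsChain (· ≤ ·) (Set.range f) := by
      rintro _ ⟨a, rfl⟩ _ ⟨b, rfl⟩ hne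
      rcases lt_trichotomy a b with h1 | h1 | h1
      · exact Or.inl (le_of_lt ((hg _ _).2 (Or.inl ⟨h1, b.2⟩)))
      · exact absurd (congrArg f h1) hne
      · exact Or.inr (le_of_lt ((hg _ _).2 (Or.inl ⟨h1, a.2⟩)))
    have h1 := Set.encard_le_chainHeight_of_isChain _ _ (Set.subset_univ _) hc
    rwa [← Set.image_univ, hf.encard_image, Set.encard_univ, ENat.card_eq_coe_fintype_card,
      Fintype.card_fin] at h1

theorem hasLayers (h : Normal m C) : @HasLayers (Fin (m + 2)) (order h.valid) m :=
  ⟨m, @layers_univ m C _ (order h.valid) h (Equiv.refl _) fun _ _ => Iff.rfl, rfl⟩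

theorem exists_normal_code (o : PartialOrder (Fin (m + 2)))
    (h : @HasLayers (Fin (m + 2)) o m) :
    ∃ C, Normal m C ∧ ∃ g : Fin (m + 2) ≃ Fin (m + 2), ∀ u v, o.lt (g u) (g v) ↔ Rel m C u v := by
  obtain ⟨k, hk, hk'⟩ := h
  obtain rfl : k = m := by exact_mod_cast hk'
  obtain ⟨C, hC, g, hg⟩ := exists_valid_code hk (by simp)
  obtain ⟨C', hC', g', hg'⟩ := exists_normal hC
  exact ⟨C', hC', g'.trans g, fun u v => (hg _ _).trans (hg' u v)⟩

theorem equiv_order (o : PartialOrder (Fin (m + 2))) (h : Normal m C)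
    (g : Fin (m + 2) ≃ Fin (m + 2)) (hg : ∀ u v, o.lt (g u) (g v) ↔ Rel m C u v) :
    (isoSetoid (m + 2)).r (order h.valid) o := by
  refine ⟨⟨g, ?_⟩⟩
  intro u v
  have h1 : o.le (g u) (g v) ↔ o.lt (g u) (g v) ∨ g u = g v := le_iff_lt_or_eq
  change o.le (g u) (g v) ↔ u = v ∨ Rel m C u v
  rw [h1, hg, g.injective.eq_iff, or_comm]

/-- The unlabelled poset described by a code (and a fixed one if the code is not normal). -/
noncomputable def unlabelled (m : ℕ) (C : ChainCode) : UnlabelledPoset (m + 2) :=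
  open Classical in
  Quotient.mk (isoSetoid (m + 2)) (if h : Normal m C then order h.valid else inferInstance)

theorem unlabelled_eq (h : Normal m C) :
    unlabelled m C = Quotient.mk (isoSetoid (m + 2)) (order h.valid) := by
  unfold unlabelled
  rw [dif_pos h]

theorem injOn_unlabelled : Set.InjOn (unlabelled m) {C | Normal m C} := by
  intro C hC C' hC' heq
  rw [unlabelled_eq hC, unlabelled_eq hC'] at heq
  obtain ⟨e⟩ := Quotient.exact heq
  refine (eq_of_equiv hC hC' e.toEquiv fun u v => ?_).1
  exact (@OrderIso.lt_iff_lt _ _ (order hC.valid).toPreorder (order hC'.valid).toPreorder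
    e u v).symm

theorem numPosets_eq : numPosets (m + 2) m = {C | Normal m C}.ncard := by
  rw [← injOn_unlabelled.ncard_image]
  unfold numPosets
  congr 1
  ext x
  constructor
  · rintro ⟨o, rfl, ho⟩
    obtain ⟨C, hC, g, hg⟩ := exists_normal_code o ho
    exact ⟨C, hC, (unlabelled_eq hC).trans (Quotient.sound (equiv_order o hC g hg))⟩
  · rintro ⟨C, hC, rfl⟩
    exact ⟨order hC.valid, (unlabelled_eq hC).symm, hasLayers hC⟩

theorem numLocallyUnsymmetric_eq :
    numLocallyUnsymmetric (m + 2) m = {C | Normal m C ∧ Rigid C}.ncard := by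
  have hinj : Set.InjOn (unlabelled m) {C | Normal m C ∧ Rigid C} :=
    injOn_unlabelled.mono fun C hC => hC.1
  rw [← hinj.ncard_image]
  unfold numLocallyUnsymmetric
  congr 1
  ext x
  constructor
  · rintro ⟨o, rfl, ho, hu⟩
    obtain ⟨C, hC, g, hg⟩ := exists_normal_code o ho
    refine ⟨C, ⟨hC, ?_⟩, (unlabelled_eq hC).trans (Quotient.sound (equiv_order o hC g hg))⟩
    by_contra hR
    exact hu (@isLocallySymmetric_of_not_rigid m C _ o _ hC hR g hg)
  · rintro ⟨C, ⟨hC, hR⟩, rfl⟩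
    exact ⟨order hC.valid, (unlabelled_eq hC).symm, hasLayers hC,
      @isLocallyUnsymmetric_of_rigid m C _ (order hC.valid) _ hC hR (Equiv.refl _)
        fun _ _ => Iff.rfl⟩

end ChainCode

/-- The number of layers would be negative for n < 2; for n = 2 it would be 0, but a nonempty poset
has a layer. -/
theorem not_hasLayers {n : ℕ} (hn : n < 3) (o : PartialOrder (Fin n)) :
    ¬ @HasLayers (Fin n) o ((n : ℤ) - 2) := by
  rintro ⟨k, hk, hk'⟩
  obtain ⟨rfl, rfl⟩ : n = 2 ∧ k = 0 := by omega
  have h1 := (Set.chainHeight_eq_zero_iff _ _).1 (hk.trans Nat.cast_zero)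
  exact (Set.univ_nonempty (α := Fin 2)).ne_empty h1

end LocalSym

theorem mainTheorem3 (n : ℕ) :
    (n < 3 → LocalSym.numPosets n ((n : ℤ) - 2) = 0 ∧ LocalSym.numLocallyUnsymmetric n ((n : ℤ) - 2) = 0) ∧
    (3 ≤ n →
      (LocalSym.numPosets n ((n : ℤ) - 2) : ℚ)
        = 1 / 6 * ((n : ℚ) - 2) * ((n : ℚ) ^ 3 - 2 * (n : ℚ) ^ 2 - 5 * (n : ℚ) + 12) ∧
      (LocalSym.numLocallyUnsymmetric n ((n : ℤ) - 2) : ℚ)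
        = 1 / 6 * ((n : ℚ) - 3) * ((n : ℚ) ^ 3 - 4 * (n : ℚ) ^ 2 + 2 * (n : ℚ) - 2)) := by
  refine ⟨fun hn => ⟨?_, ?_⟩, fun hn => ?_⟩
  · rw [LocalSym.numPosets]
    refine (congrArg Set.ncard (Set.eq_empty_iff_forall_notMem.2 ?_)).trans (Set.ncard_empty _)
    rintro x ⟨o, -, ho⟩
    exact LocalSym.not_hasLayers hn o ho
  · rw [LocalSym.numLocallyUnsymmetric]
    refine (congrArg Set.ncard (Set.eq_empty_iff_forall_notMem.2 ?_)).trans (Set.ncard_empty _)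
    rintro x ⟨o, -, ho, -⟩
    exact LocalSym.not_hasLayers hn o ho
  · obtain ⟨m, rfl⟩ : ∃ m, n = m + 2 := ⟨n - 2, by omega⟩
    have hm : ((m + 2 : ℕ) : ℤ) - 2 = m := by
      push_cast
      ring
    rw [hm, LocalSym.ChainCode.numPosets_eq, LocalSym.ChainCode.numLocallyUnsymmetric_eq,
      LocalSym.ChainCode.ncard_normal, LocalSym.ChainCode.ncard_normal_rigid m (by omega)]
    push_cast
    constructor <;> ring
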